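/- **Conventions.** For $x\in\{0,1\}^n$ and $p\in\mathbb R^n$ let $\Delta(x,p)=\|x-p\|_2^2$. A *Hamming nearest neighbor (HNN) representation* with $m$ anchors of $f:\{0,1\}^n\to\{0,1\}$ is a pair of disjoint sets $P,N\subseteq\{0,1\}^n$ with $|P|+|N|=m$ such that, for every $x\in\{0,1\}^n$, $f(x)=1$ iff some $p\in P$ satisfies $\Delta(x,p)<\Delta(x,q)$ for all $q\in N$, and $f(x)=0$ iff some $q\in N$ satisfies $\Delta(x,q)<\Delta(x,p)$ for all $p\in P$. $\mathrm{HNN}$ is the class of families of Boolean functions having HNN representations with a number of anchors polynomial in the number of variables. $f:\{0,1\}^n\to\{0,1\}$ is a *subfunction* of $g:\{0,1\}^{m}\to\{0,1\}$ if $f(x)=g(v(x))$ for all $x$, where every coordinate of $v(x)$ is a fixed variable $x_i$ or a fixed constant. The closure $\overline{\mathrm{HNN}}$ is the class of families of subfunctions of members of $\mathrm{HNN}$, where the number $m$ of variables of $g$ is bounded by a polynomial in $n$. A *min-plus polynomial threshold function (mpPTF)* with $\ell_1+\ell_2$ terms computes $f$ by $f(x)=1\iff\min_{i\le \ell_1}L_i(x)\le\min_{j\le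 \ell_2}R_j(x)$, with affine linear forms $L_i,R_j$ with integer coefficients (a minimum over no forms is $+\infty$); its maximum weight is the largest absolute value of a coefficient, constant terms included. $\mathrm{MAJ}\circ\mathrm{MAJ}$ is the class of families of Boolean functions computed by depth-two circuits consisting of one threshold gate applied to the outputs of threshold gates whose inputs are variables, negated variables and constants, where the number of gates and the absolute values of the (integer) weights are bounded by a polynomial in the number of variables. $\mathrm{OMB}(x_1,\dots,x_n)=\max\{i:x_i=1\}\bmod 2$ (and $0$ if $x=0$), and $(\mathrm{OMB}\circ\mathrm{AND}_2)(x,y)=\mathrm{OMB}(x_1\wedge y_1,\dots,x_n\wedge y_n)$, a function of $2n$ variables. **Theorem.** $\mathrm{HNN}\not\subseteq\mathrm{MAJ}\circ\mathrm{MAJ}$. More precisely, there is a family of Boolean functions $f_n:\{0,1\}^n\to\{0,1\}$ such that every $f_n$ has an HNN representation with $n+1$ anchors, and $(f_n)_n\notin\mathrm{MAJ}\circ\mathrm{MAJ}$. Moreover: 1. for every $n$, $\mathrm{OMB}\circ\mathrm{AND}_2$ on $2n$ variables is computed by an mpPTF with $n+1$ terms and maximum weight at most $n+1$; 2. $\mathrm{OMB}\circ\mathrm{AND}_2\in\overline{\mathrm{HNN}}$;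 and there is a polynomial $p$ such that for every $n$, $\mathrm{OMB}\circ\mathrm{AND}_2$ on $2n$ variables is a subfunction of a Boolean function of at most $p(n)$ variables that has an HNN representation with $n+1$ anchors; 3. $\mathrm{OMB}\circ\mathrm{AND}_2\notin\mathrm{MAJ}\circ\mathrm{MAJ}$. -/

import Mathlib

namespace NearestNeighbor

/-- Boolean functions of the variables indexed by `ι`. -/
abbrev BoolFn (ι : Type) : Type := (ι → Bool) → Bool

/-- A family of Boolean functions; the `k`-th one has the variables `ι k`.
`BoolFamily Fin` is the type of families with one `n`-variate function for each `n`. -/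
abbrev BoolFamily (ι : ℕ → Type) : Type := ∀ k, BoolFn (ι k)

/-! ### Nearest neighbor representations -/

/-- A Boolean vector as a real vector. -/
def toReal {ι : Type} (x : ι → Bool) : ι → ℝ := fun i => if x i then 1 else 0

/-- The squared Euclidean distance. -/
def sqDist {ι : Type} [Fintype ι] (x y : ι → ℝ) : ℝ := ∑ i, (x i - y i) ^ 2

/-- `P`, `N` are the positive and the negative anchors of a nearest neighbor representation of `f`:
on the inputs where `f` is 1 some positive anchor is strictly closer than all negative ones, on the
inputs where `f` is 0 some negative anchor is strictly closer than all positive ones. -/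
def IsNNRep {ι : Type} [Fintype ι] (f : BoolFn ι) (P N : Finset (ι → ℝ)) : Prop :=
  Disjoint P N ∧
    ∀ x : ι → Bool,
      (f x = true ↔ ∃ p ∈ P, ∀ q ∈ N, sqDist (toReal x) p < sqDist (toReal x) q) ∧
      (f x = false ↔ ∃ q ∈ N, ∀ p ∈ P, sqDist (toReal x) q < sqDist (toReal x) p)

/-- `f` has a Hamming nearest neighbor representation (all anchors are 0/1 vectors) with exactly
`m` anchors. -/
def HasHNNRep {ι : Type} [Fintype ι] (f : BoolFn ι) (m : ℕ) : Prop :=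
  ∃ P N : Finset (ι → ℝ),
    IsNNRep f P N ∧
    (∀ a ∈ P, ∀ i, a i = 0 ∨ a i = 1) ∧
    (∀ a ∈ N, ∀ i, a i = 0 ∨ a i = 1) ∧
    P.card + N.card = m

/-- The class `HNN`: polynomially many Boolean anchors. -/
def HNN (ι : ℕ → Type) [∀ k, Fintype (ι k)] : Set (BoolFamily ι) :=
  {f | ∃ p : Polynomial ℕ, ∀ k, ∃ m ≤ p.eval (Fintype.card (ι k)), HasHNNRep (f k) m}

/-! ### Subfunctions and the closure of a class -/

/-- `f` is obtained from `g` by a substitution `v` that puts a variable of `f` or a constant in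
place of every variable of `g`. -/
def IsSubfunction {ι κ : Type} (f : BoolFn ι) (g : BoolFn κ) : Prop :=
  ∃ v : κ → ι ⊕ Bool, ∀ x : ι → Bool, f x = g (fun j => Sum.elim x id (v j))

/-- The closure of a class: subfunctions of members of the class, with polynomially many variables
before the substitution. -/
def subClosure (C : Set (BoolFamily Fin)) (ι : ℕ → Type) [∀ k, Fintype (ι k)] :
    Set (BoolFamily ι) :=
  {f | ∃ g ∈ C, ∃ p : Polynomial ℕ, ∀ k, ∃ m ≤ p.eval (Fintype.card (ι k)),
    IsSubfunction (f k) (g m)}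

/-! ### Min-plus polynomial threshold functions -/

/-- A linear form with integer coefficients (the constant coefficient included). -/
structure LinForm (ι : Type) where
  coeff : ι → ℤ
  const : ℤ

/-- The value of a linear form at a Boolean vector. -/
def LinForm.eval {ι : Type} [Fintype ι] (L : LinForm ι) (x : ι → Bool) : ℤ :=
  ∑ i, L.coeff i * (if x i then 1 else 0) + L.const

/-- All coefficients of `L`, the constant one included, are at most `W` in absolute value. -/
def LinForm.WeightLE {ι : Type} (L : LinForm ι) (W : ℕ) : Prop :=
  (∀ i, |L.coeff i| ≤ (W : ℤ)) ∧ |L.const| ≤ (W : ℤ)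

/-- `f` is computed by a min-plus polynomial threshold function with `m` terms and maximum weight at
most `W`, that is `f x = 1 ↔ min L i x ≤ min R j x`. A minimum over no forms is `+∞`. -/
def HasMpPTF {ι : Type} [Fintype ι] (f : BoolFn ι) (m W : ℕ) : Prop :=
  ∃ (l₁ l₂ : ℕ) (L : Fin l₁ → LinForm ι) (R : Fin l₂ → LinForm ι),
    l₁ + l₂ = m ∧
    (∀ i, (L i).WeightLE W) ∧ (∀ j, (R j).WeightLE W) ∧
    ∀ x : ι → Bool,
      f x = true ↔
        Finset.univ.inf (fun i => ((L i).eval x : WithTop ℤ)) ≤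
          Finset.univ.inf (fun j => ((R j).eval x : WithTop ℤ))

/-! ### Depth-two majority circuits -/

/-- A threshold gate with integer weights and inputs indexed by `κ`. -/
structure ThresholdGate (κ : Type) where
  weight : κ → ℤ
  threshold : ℤ

/-- The output of a threshold gate. -/
def ThresholdGate.eval {κ : Type} [Fintype κ] (G : ThresholdGate κ) (y : κ → Bool) : Bool :=
  decide (G.threshold ≤ ∑ j, G.weight j * (if y j then 1 else 0))

/-- The possible inputs of a circuit: variables, negated variables, and the two constants. -/
abbrev Literal (ι : Type) : Type := ι ⊕ ι ⊕ Bool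

/-- The value of a literal. -/
def Literal.value {ι : Type} (x : ι → Bool) : Literal ι → Bool :=
  Sum.elim x (Sum.elim (fun i => !x i) id)

/-- A depth-two threshold circuit: a threshold gate applied to `s` threshold gates, each of which
reads literals (a literal with weight 0 is not read). -/
structure DepthTwoCircuit (ι : Type) where
  s : ℕ
  bottom : Fin s → ThresholdGate (Literal ι)
  top : ThresholdGate (Fin s)

/-- The function computed by a depth-two circuit. -/
def DepthTwoCircuit.eval {ι : Type} [Fintype ι] (C : DepthTwoCircuit ι) : BoolFn ι :=
  fun x => C.top.eval (fun j => (C.bottom j).eval (fun l => Literal.value x l))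

/-- The number of gates. -/
def DepthTwoCircuit.size {ι : Type} (C : DepthTwoCircuit ι) : ℕ := C.s + 1

/-- All weights of all gates are at most `W` in absolute value. -/
def DepthTwoCircuit.WeightLE {ι : Type} (C : DepthTwoCircuit ι) (W : ℕ) : Prop :=
  (∀ j, |C.top.weight j| ≤ (W : ℤ)) ∧ ∀ j l, |(C.bottom j).weight l| ≤ (W : ℤ)

/-- The class `MAJ ∘ MAJ`: depth-two threshold circuits with polynomially many gates and
polynomially bounded integer weights. -/
def MAJMAJ (ι : ℕ → Type) [∀ k, Fintype (ι k)] : Set (BoolFamily ι) :=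
  {f | ∃ p : Polynomial ℕ, ∀ k, ∃ C : DepthTwoCircuit (ι k),
    C.size ≤ p.eval (Fintype.card (ι k)) ∧
    C.WeightLE (p.eval (Fintype.card (ι k))) ∧
    C.eval = f k}

/-! ### The odd-max-bit function -/

/-- `OMB (x₁, …, xₙ) = max {i : xᵢ = 1} mod 2`, and 0 if all `xᵢ` are 0. The element `i : Fin n` is
the index `i + 1` of the 1-based numbering. -/
def omb {n : ℕ} (x : Fin n → Bool) : Bool :=
  decide ((Finset.univ.filter (fun i => x i = true)).sup (fun i : Fin n => (i : ℕ) + 1) % 2 = 1)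

/-- `OMB ∘ AND₂` on the `2n` variables `x₁, …, xₙ, y₁, …, yₙ`. -/
def ombAnd2 : BoolFamily (fun n => Fin n ⊕ Fin n) :=
  fun _ z => omb (fun i => z (Sum.inl i) && z (Sum.inr i))

end NearestNeighbor

open NearestNeighbor

/-! Lower bound. `OMB ∘ AND₂` can simulate selection: `x` stores `b` bits for each of `n = L * m`
cells, `y` picks one bit per cell, and the value is the parity of the highest of `L` levels (of `m`
cells each) that holds a selected 1. Shifting the top sum of a MAJ ∘ MAJ circuit by its threshold
gives a real function of `(x, y)` with the right signs and margin 1/2. It is a short combination of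
products `u x * v y`, because a bottom gate depends on `x` only through an integer of polynomial
range. Products correlate exponentially weakly with parities of many selected bits
(`corr_sq_mul_le`). Averaging over all `(x, y)` with the same selected bits therefore leaves a
function of `n` bits with negligible high-degree part (`exists_lowDegree_of_smallCorr`): the level
function would have a sign representation of constant degree `d`, margin 1/4 and polynomial
magnitude.

This is impossible, since each level doubles the magnitude (`exists_two_pow_le_abs_lowDegree`).
Setting the bits of one level to 1 with probability `t / m` turns the function into a polynomial in
`t` of degree at most `d`, and such a polynomial cannot drop sharply from 0 to all of `1, …, m`
(`exists_nat_eval_ge`). Here `d` depends only on the circuit's polynomial bound and `m` only on `d`,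
so `L` can be taken large enough for `2 ^ L` to win.

Upper bounds. Linearly growing weights let the largest satisfied conjunction win a minimum. For
Boolean anchors, weight `i + 1` is realized by `i + 1` copies of a variable, and opposite parities
of positive and negative anchors exclude ties on every input. Closure of MAJ ∘ MAJ under
substitutions carries the lower bound over to the HNN function. -/

namespace NearestNeighbor

/-! ### Univariate extrapolation -/

/-- Richardson extrapolation: combining `r(t)` and `r(K t)` cancels the leading coefficient while
keeping the value at 0, which drives the induction on the degree. What matters is that `m` depends
on `d` and `ε` alone. -/
theorem exists_nat_eval_ge (d : ℕ) : ∀ ε : ℝ, 0 < ε → ∃ m : ℕ, 0 < m ∧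
    ∀ (r : Polynomial ℝ) (A : ℝ), r.natDegree ≤ d →
      (∀ t : ℕ, 1 ≤ t → t ≤ m → |r.eval (t : ℝ)| ≤ A) →
      ∃ t : ℕ, 1 ≤ t ∧ t ≤ m ∧ r.eval 0 - ε * A ≤ r.eval (t : ℝ) := by
  induction d with
  | zero =>
    intro ε hε
    refine ⟨1, one_pos, fun r A hr hA => ⟨1, le_rfl, le_rfl, ?_⟩⟩
    have h0 := hA 1 le_rfl le_rfl
    have hA0 : 0 ≤ A := (abs_nonneg _).trans h0
    rw [Polynomial.eq_C_of_natDegree_le_zero hr]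
    simp only [Polynomial.eval_C]
    nlinarith
  | succ d ih =>
    intro ε hε
    obtain ⟨m, hm, h⟩ := ih (ε / 6) (by positivity)
    -- `K > 2` gives `(Q + 1) / (Q - 1) ≤ 3`, hence the bound `3 * A` for `s`; `K > 8 / ε` makes the
    -- error `2 * A / (Q - 1)` of replacing `s` by `r` at most half of `ε * A`. The other half is `ε
    -- / 6 * (3 * A)`.
    obtain ⟨K, hK⟩ := exists_nat_gt (8 / ε + 2)
    have hK2 : (2 : ℝ) < K := by have : 0 < 8 / ε := by positivity
                                 linarith
    have hK8 : 8 ≤ ε * K := by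
      have : 8 / ε ≤ K := by linarith
      rw [div_le_iff₀ hε] at this; linarith
    have hK1 : 1 ≤ K := by
      have : (1 : ℝ) ≤ K := by linarith
      exact_mod_cast this
    refine ⟨K * m, by positivity, fun r A hr hA => ?_⟩
    have hA0 : 0 ≤ A := (abs_nonneg _).trans (hA 1 le_rfl (by nlinarith))
    set Q : ℝ := (K : ℝ) ^ (d + 1) with hQ
    have hQK : (K : ℝ) ≤ Q := by
      rw [hQ]; exact le_self_pow₀ (by linarith) (by omega)
    let s : Polynomial ℝ := Polynomial.C (Q / (Q - 1)) * r -
      Polynomial.C (1 / (Q - 1)) * r.comp (Polynomial.C (K : ℝ) * Polynomial.X)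
    have hQ1 : 0 < Q - 1 := by linarith
    have hs : ∀ t : ℝ, s.eval t = (Q * r.eval t - r.eval (K * t)) / (Q - 1) := by
      intro t
      simp only [s, Polynomial.eval_sub, Polynomial.eval_mul, Polynomial.eval_C,
        Polynomial.eval_comp, Polynomial.eval_X]
      ring
    have hcomp : ∀ k, (r.comp (Polynomial.C (K : ℝ) * Polynomial.X)).coeff k
        = r.coeff k * (K : ℝ) ^ k := fun k => Polynomial.comp_C_mul_X_coeff
    have hsdeg : s.natDegree ≤ d := by
      rw [Polynomial.natDegree_le_iff_coeff_eq_zero]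
      intro k hk
      simp only [s, Polynomial.coeff_sub, Polynomial.coeff_C_mul, hcomp]
      rcases Nat.lt_or_ge (d + 1) k with h1 | h1
      · rw [Polynomial.coeff_eq_zero_of_natDegree_lt (lt_of_le_of_lt hr h1)]; ring
      · obtain rfl : k = d + 1 := by omega
        rw [← hQ]; ring
    have hbound : ∀ t : ℕ, 1 ≤ t → t ≤ m → |r.eval (t : ℝ)| ≤ A ∧ |r.eval ((K : ℝ) * t)| ≤ A := by
      intro t h1 h2
      refine ⟨hA t h1 (by nlinarith), ?_⟩
      have := hA (K * t) (by nlinarith) (by nlinarith)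
      rwa [Nat.cast_mul] at this
    obtain ⟨t, ht1, ht2, ht⟩ := h s (3 * A) hsdeg (by
      intro t h1 h2
      obtain ⟨h3, h4⟩ := hbound t h1 h2
      rw [hs, abs_div, abs_of_pos hQ1, div_le_iff₀ hQ1]
      rw [abs_le] at h3 h4 ⊢
      constructor <;> nlinarith)
    refine ⟨t, ht1, by nlinarith, ?_⟩
    obtain ⟨h3, h4⟩ := hbound t ht1 ht2
    have h0 : s.eval 0 = r.eval 0 := by
      rw [hs, mul_zero]; field_simp
    rw [h0, hs, le_div_iff₀ hQ1] at ht
    rw [abs_le] at h3 h4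
    have h5 : r.eval 0 - ε / 6 * (3 * A) ≤ r.eval (t : ℝ) + 2 * A / (Q - 1) := by
      rw [← sub_le_iff_le_add', le_div_iff₀ hQ1]
      nlinarith
    have h6 : 2 * A / (Q - 1) ≤ ε / 2 * A := by
      rw [div_le_iff₀ hQ1]
      have : 2 ≤ ε / 2 * (Q - 1) := by nlinarith
      nlinarith
    linarith

/-! ### Parities and low-degree functions -/

/-- The sign `(-1) ^ b` of a bit. -/
noncomputable def bitSign (b : Bool) : ℝ := if b then -1 else 1

/-- The parity function of the coordinates in `S`, with values `±1`. -/
noncomputable def parity {ι : Type} (S : Finset ι) (z : ι → Bool) : ℝ := ∏ i ∈ S, bitSign (z i)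

theorem abs_bitSign (b : Bool) : |bitSign b| = 1 := by cases b <;> simp [bitSign]

theorem abs_parity {ι : Type} (S : Finset ι) (z : ι → Bool) : |parity S z| = 1 := by
  simp [parity, Finset.abs_prod, abs_bitSign]

/-- The function with Fourier coefficients `c`, cut off above degree `d`. -/
noncomputable def lowDegree {ι : Type} [Fintype ι] (d : ℕ) (c : Finset ι → ℝ) (z : ι → Bool) : ℝ :=
  ∑ S with S.card ≤ d, c S * parity S z

/-- The probability of `w` when every bit is 1 with probability `p`, independently. -/
noncomputable def biasedWeight {κ : Type} [Fintype κ] (p : ℝ) (w : κ → Bool) : ℝ :=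
  ∏ j, if w j then p else 1 - p

theorem sum_prod_bool {κ : Type} [Fintype κ] [DecidableEq κ] (g : κ → Bool → ℝ) :
    ∑ w : κ → Bool, ∏ j, g j (w j) = ∏ j, (g j true + g j false) := by
  have := Finset.prod_univ_sum (fun _ : κ => (Finset.univ : Finset Bool)) g
  rw [Fintype.piFinset_univ] at this
  simpa using this.symm

theorem sum_biasedWeight {κ : Type} [Fintype κ] [DecidableEq κ] (p : ℝ) :
    ∑ w : κ → Bool, biasedWeight p w = 1 := by
  have := sum_prod_bool (fun (_ : κ) b => if b then p else 1 - p)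
  simpa [biasedWeight] using this

theorem biasedWeight_nonneg {κ : Type} [Fintype κ] {p : ℝ} (h0 : 0 ≤ p) (h1 : p ≤ 1)
    (w : κ → Bool) : 0 ≤ biasedWeight p w :=
  Finset.prod_nonneg fun j _ => by split_ifs <;> linarith

/-- Replace level `k` of `z` by `w`. -/
def setLevel {α κ : Type} [DecidableEq α] (k : α) (z : α × κ → Bool) (w : κ → Bool) :
    α × κ → Bool := fun i => if i.1 = k then w i.2 else z i

theorem sum_biasedWeight_mul_parity {α κ : Type} [DecidableEq α] [Fintype κ] [DecidableEq κ]
    (p : ℝ) (k : α) (z : α × κ → Bool) (S : Finset (α × κ)) :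
    ∑ w : κ → Bool, biasedWeight p w * parity S (setLevel k z w) =
      (∏ i ∈ S with i.1 ≠ k, bitSign (z i)) *
        (1 - 2 * p) ^ (Finset.univ.filter (fun j : κ => (k, j) ∈ S)).card := by
  have h1 : ∀ w : κ → Bool, parity S (setLevel k z w) =
      (∏ i ∈ S with i.1 ≠ k, bitSign (z i)) * ∏ j, if (k, j) ∈ S then bitSign (w j) else 1 := by
    intro w
    rw [parity, ← Finset.prod_filter_mul_prod_filter_not S (fun i => i.1 ≠ k)]
    congr 1
    · refine Finset.prod_congr rfl fun i hi => ?_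
      simp [setLevel, (Finset.mem_filter.1 hi).2]
    · rw [← Finset.prod_filter]
      symm
      refine Finset.prod_bij (fun j _ => (k, j)) ?_ ?_ ?_ ?_
      · intro j hj; simpa using hj
      · intro j _ j' _ h; simpa using h
      · rintro ⟨a, j⟩ hi
        simp only [ne_eq, not_not, Finset.mem_filter] at hi
        obtain ⟨hi, rfl⟩ := hi
        exact ⟨j, by simpa using hi, rfl⟩
      · intro j _; simp [setLevel]
  simp only [h1]
  calc _ = (∏ i ∈ S with i.1 ≠ k, bitSign (z i)) * ∑ w : κ → Bool, ∏ j,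
        ((if w j then p else 1 - p) * if (k, j) ∈ S then bitSign (w j) else 1) := by
        rw [Finset.mul_sum]
        refine Finset.sum_congr rfl fun w _ => ?_
        rw [Finset.prod_mul_distrib, biasedWeight]; ring
    _ = _ := by
        rw [sum_prod_bool (fun j b => (if b then p else 1 - p) *
          if (k, j) ∈ S then bitSign b else 1)]
        congr 1
        rw [← Finset.prod_const, Finset.prod_filter]
        refine Finset.prod_congr rfl fun j _ => ?_
        by_cases hj : (k, j) ∈ S
        · simp only [hj, if_true, bitSign]; norm_num; ring
        · simp [hj]

/-- A bit that is 1 with probability `p` has expected sign `1 - 2p`, so by independence a parity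
averages to a power of `1 - 2p` whose exponent is at most the size of the parity. -/
theorem exists_polynomial_average {α κ : Type} [Fintype α] [DecidableEq α] [Fintype κ]
    [DecidableEq κ] (d : ℕ) (c : Finset (α × κ) → ℝ) (k : α) (z : α × κ → Bool) (s : ℝ) :
    ∃ r : Polynomial ℝ, r.natDegree ≤ d ∧ ∀ t : ℝ, r.eval t =
      ∑ w : κ → Bool, biasedWeight (t * s) w * lowDegree d c (setLevel k z w) := by
  refine ⟨∑ S with S.card ≤ d, Polynomial.C (c S * ∏ i ∈ S with i.1 ≠ k, bitSign (z i)) *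
    (1 - Polynomial.C (2 * s) * Polynomial.X) ^
      (Finset.univ.filter (fun j : κ => (k, j) ∈ S)).card, ?_, fun t => ?_⟩
  · refine Polynomial.natDegree_sum_le_of_forall_le _ _ fun S hS => ?_
    refine (Polynomial.natDegree_C_mul_le _ _).trans ?_
    refine Polynomial.natDegree_pow_le.trans ((Nat.mul_le_mul_left _ (?_ : _ ≤ 1)).trans ?_)
    · compute_degree
    · rw [mul_one]
      refine le_trans ?_ (Finset.mem_filter.1 hS).2
      refine Finset.card_le_card_of_injOn (fun j => (k, j)) ?_ ?_
      · intro j hj; simpa using hj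
      · intro j _ j' _ h; simpa using h
  · simp only [lowDegree, Polynomial.eval_finsetSum, Polynomial.eval_mul, Polynomial.eval_C,
      Polynomial.eval_pow, Polynomial.eval_sub, Polynomial.eval_one, Polynomial.eval_X,
      Finset.mul_sum]
    rw [Finset.sum_comm]
    refine Finset.sum_congr rfl fun S _ => ?_
    rw [mul_assoc, show 1 - 2 * s * t = 1 - 2 * (t * s) by ring,
      ← sum_biasedWeight_mul_parity, Finset.mul_sum]
    refine Finset.sum_congr rfl fun w _ => ?_
    ring

theorem biasedWeight_const_false {κ : Type} [Fintype κ] (p : ℝ) :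
    biasedWeight p (fun _ : κ => false) = (1 - p) ^ Fintype.card κ := by
  simp [biasedWeight]

theorem sum_biasedWeight_zero_mul {κ : Type} [Fintype κ] [DecidableEq κ] (h : (κ → Bool) → ℝ) :
    ∑ w, biasedWeight 0 w * h w = h (fun _ => false) := by
  rw [Finset.sum_eq_single (fun _ => false)]
  · simp [biasedWeight_const_false]
  · intro w _ hw
    obtain ⟨j, hj⟩ := Function.ne_iff.1 hw
    rw [biasedWeight, Finset.prod_eq_zero (Finset.mem_univ j) (by simp_all), zero_mul]
  · simp

theorem one_sub_inv_pow_le (m : ℕ) {t : ℕ} (ht : 1 ≤ t) (htm : t ≤ m) :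
    (1 - (t : ℝ) * (m : ℝ)⁻¹) ^ m ≤ 1 / 2 := by
  have hm : (0 : ℝ) < m := by exact_mod_cast (by omega : 0 < m)
  have ht' : (1 : ℝ) ≤ t := by exact_mod_cast ht
  have htm' : (t : ℝ) ≤ m := by exact_mod_cast htm
  have h1 : (t : ℝ) * (m : ℝ)⁻¹ ≤ 1 := by
    rw [← div_eq_mul_inv]; exact div_le_one_of_le₀ htm' hm.le
  have h2 : (1 - (t : ℝ) * (m : ℝ)⁻¹) ≤ Real.exp (-((t : ℝ) * (m : ℝ)⁻¹)) := by
    have := Real.add_one_le_exp (-((t : ℝ) * (m : ℝ)⁻¹)); linarith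
  calc _ ≤ (Real.exp (-((t : ℝ) * (m : ℝ)⁻¹))) ^ m := by gcongr
    _ = Real.exp (-t) := by rw [← Real.exp_nat_mul]; congr 1; field_simp
    _ ≤ Real.exp (-1) := Real.exp_le_exp.2 (by linarith)
    _ ≤ 1 / 2 := by
      rw [Real.exp_neg, one_div]
      gcongr
      have := Real.add_one_le_exp (1 : ℝ); linarith

/-- If `m` is large compared with `d`, then every level doubles the absolute value that a function
of degree `d` must attain in order to have the signs of a decision list with alternating levels. -/
theorem exists_two_pow_le_abs_lowDegree {d m : ℕ}
    (hext : ∀ (r : Polynomial ℝ) (A : ℝ), r.natDegree ≤ d →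
      (∀ t : ℕ, 1 ≤ t → t ≤ m → |r.eval (t : ℝ)| ≤ A) →
      ∃ t : ℕ, 1 ≤ t ∧ t ≤ m ∧ r.eval 0 - 1 / 8 * A ≤ r.eval (t : ℝ))
    (L : ℕ) (c : Finset (Fin L × Fin m) → ℝ)
    (h0 : lowDegree d c (fun _ => false) ≤ -(1 / 4))
    (h : ∀ (z : Fin L × Fin m → Bool) (k : Fin L), (∃ j, z (k, j) = true) →
      (∀ l, k < l → ∀ j, z (l, j) = false) → 1 / 4 ≤ (-1) ^ (k : ℕ) * lowDegree d c z) :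
    ∃ z, 2 ^ L / 4 ≤ |lowDegree d c z| := by
  have key : ∀ k : ℕ, k ≤ L → ∃ z : Fin L × Fin m → Bool,
      (∀ l : Fin L, k ≤ l → ∀ j, z (l, j) = false) ∧
      2 ^ k / 4 ≤ (-1) ^ (k + 1) * lowDegree d c z := by
    intro k
    induction k with
    | zero =>
      intro _
      refine ⟨fun _ => false, fun _ _ _ => rfl, ?_⟩
      simp only [pow_zero, zero_add, pow_one]; linarith
    | succ k ih =>
      intro hk
      obtain ⟨z, hz, hv⟩ := ih (by omega)
      set v : ℝ := (-1) ^ (k + 1) * lowDegree d c z with hvdef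
      have hv0 : 0 < v := lt_of_lt_of_le (by positivity) hv
      let k' : Fin L := ⟨k, by omega⟩
      have hsupp : ∀ w (l : Fin L), k + 1 ≤ l → ∀ j, setLevel k' z w (l, j) = false := by
        intro w l hl j
        have : l ≠ k' := by intro e; rw [e] at hl; simp [k'] at hl
        simp only [setLevel, this, if_false]
        exact hz l (by omega) j
      -- Any 1 on level `k` makes it the top level, whose required sign is opposite to the sign at
      -- `z`.
      have hneg : ∀ w : Fin m → Bool, w ≠ (fun _ => false) →
          (-1) ^ (k + 1) * lowDegree d c (setLevel k' z w) ≤ 0 := by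
        intro w hw
        obtain ⟨j, hj⟩ := Function.ne_iff.1 hw
        have := h (setLevel k' z w) k' ⟨j, by simpa [setLevel] using hj⟩
          (fun l hl j => hsupp w l (by simpa [k', Fin.lt_def] using hl) j)
        have e : ((k' : Fin L) : ℕ) = k := rfl
        rw [e] at this
        rw [pow_succ]; linarith
      have hzero : setLevel k' z (fun _ => false) = z := by
        funext ⟨l, j⟩
        by_cases hl : l = k'
        · subst hl; simp [setLevel, hz k' le_rfl j]
        · simp [setLevel, hl]
      by_contra hcon
      push Not at hcon
      -- If no choice of level `k` reaches the doubled magnitude, all values lie between `-2v` and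
      -- `v`.
      have hlow : ∀ w, -(2 * v) ≤ (-1) ^ (k + 1) * lowDegree d c (setLevel k' z w) := by
        intro w
        have := hcon (setLevel k' z w) (hsupp w)
        have e : (2 : ℝ) ^ (k + 1) / 4 ≤ 2 * v := by rw [pow_succ]; linarith
        rw [pow_succ (-1 : ℝ) (k + 1)] at this
        linarith
      have hup : ∀ w, (-1) ^ (k + 1) * lowDegree d c (setLevel k' z w) ≤
          if w = (fun _ => false) then v else 0 := by
        intro w
        split_ifs with hw
        · rw [hw, hzero]
        · exact hneg w hw
      obtain ⟨r, hrd, hr⟩ := exists_polynomial_average d c k' z ((m : ℝ)⁻¹)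
      have hr' : ∀ t : ℝ, (Polynomial.C ((-1) ^ (k + 1)) * r).eval t =
          ∑ w, biasedWeight (t * (m : ℝ)⁻¹) w *
            ((-1) ^ (k + 1) * lowDegree d c (setLevel k' z w)) := by
        intro t
        rw [Polynomial.eval_mul, Polynomial.eval_C, hr, Finset.mul_sum]
        exact Finset.sum_congr rfl fun w _ => by ring
      have hprob : ∀ t : ℕ, t ≤ m → 0 ≤ (t : ℝ) * (m : ℝ)⁻¹ ∧ (t : ℝ) * (m : ℝ)⁻¹ ≤ 1 := by
        intro t htm
        refine ⟨by positivity, ?_⟩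
        rw [← div_eq_mul_inv]
        exact div_le_one_of_le₀ (by exact_mod_cast htm) (by positivity)
      obtain ⟨t, ht1, htm, ht⟩ := hext (Polynomial.C ((-1) ^ (k + 1)) * r) (2 * v)
        ((Polynomial.natDegree_C_mul_le _ _).trans hrd) (by
          intro t ht1 htm
          rw [hr']
          refine (Finset.abs_sum_le_sum_abs _ _).trans ?_
          calc _ ≤ ∑ w : Fin m → Bool, biasedWeight ((t : ℝ) * (m : ℝ)⁻¹) w * (2 * v) := by
                refine Finset.sum_le_sum fun w _ => ?_
                have hb := biasedWeight_nonneg (hprob t htm).1 (hprob t htm).2 w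
                rw [abs_mul, abs_of_nonneg hb]
                refine mul_le_mul_of_nonneg_left (abs_le.2 ⟨hlow w, ?_⟩) hb
                have := hup w
                split_ifs at this <;> linarith
            _ = 2 * v := by rw [← Finset.sum_mul, sum_biasedWeight, one_mul])
      have e0 : (Polynomial.C ((-1) ^ (k + 1)) * r).eval 0 = v := by
        rw [hr', zero_mul, sum_biasedWeight_zero_mul, hzero]
      -- Only the all-zero level contributes positively, and its probability is at most 1/2 once `t
      -- ≥ 1`. Extrapolation promises at least `v - (1/8) * 2v = 3v/4`, a contradiction.
      have e1 : (Polynomial.C ((-1) ^ (k + 1)) * r).eval (t : ℝ) ≤ 1 / 2 * v := by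
        rw [hr']
        calc _ ≤ ∑ w : Fin m → Bool, biasedWeight ((t : ℝ) * (m : ℝ)⁻¹) w *
              (if w = (fun _ => false) then v else 0) :=
              Finset.sum_le_sum fun w _ => mul_le_mul_of_nonneg_left (hup w)
                (biasedWeight_nonneg (hprob t htm).1 (hprob t htm).2 w)
          _ = (1 - (t : ℝ) * (m : ℝ)⁻¹) ^ m * v := by
              simp [biasedWeight_const_false]
          _ ≤ 1 / 2 * v := by
              have := one_sub_inv_pow_le m ht1 htm
              gcongr
      rw [e0] at ht
      linarith
  obtain ⟨z, -, hz⟩ := key L le_rfl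
  refine ⟨z, hz.trans ((le_abs_self _).trans ?_)⟩
  rw [abs_mul, abs_pow, abs_neg, abs_one, one_pow, one_mul]

/-! ### Correlation with the parities of selected bits -/

/-- The bits of `x` that are selected by `y`. -/
def select {ι β : Type} (x : ι → β → Bool) (y : ι → β) : ι → Bool := fun i => x i (y i)

theorem bitSign_mul_self (b : Bool) : bitSign b * bitSign b = 1 := by cases b <;> simp [bitSign]

theorem bitSign_not (b : Bool) : bitSign (!b) = -bitSign b := by cases b <;> simp [bitSign]

theorem parity_mul_self {ι : Type} (S : Finset ι) (z : ι → Bool) :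
    parity S z * parity S z = 1 := by
  simp [parity, ← Finset.prod_mul_distrib, bitSign_mul_self]

/-- Flipping the bit of `x` at `(i, y i)` is an involution that negates the first parity and, as
`y'` does not select that bit, preserves the second. -/
theorem sum_parity_mul_parity_eq_zero {ι β : Type} [Fintype ι] [DecidableEq ι] [Fintype β]
    [DecidableEq β] {S : Finset ι} {y y' : ι → β} {i : ι} (hi : i ∈ S) (h : y i ≠ y' i) :
    ∑ x : ι → β → Bool, parity S (select x y) * parity S (select x y') = 0 := by
  let flip : (ι → β → Bool) → (ι → β → Bool) := fun x =>
    Function.update x i (Function.update (x i) (y i) (!x i (y i)))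
  have hflip : Function.Involutive flip := by
    intro x; simp [flip]
  have h1 : ∀ x, parity S (select (flip x) y) = -parity S (select x y) := by
    intro x
    rw [parity, parity, ← Finset.mul_prod_erase _ _ hi, ← Finset.mul_prod_erase _ _ hi, ← neg_mul]
    congr 1
    · simp [select, flip, bitSign_not]
    · refine Finset.prod_congr rfl fun j hj => ?_
      simp [select, flip, (Finset.mem_erase.1 hj).1]
  have h2 : ∀ x, parity S (select (flip x) y') = parity S (select x y') := by
    intro x
    refine Finset.prod_congr rfl fun j _ => ?_
    by_cases hj : j = i
    · subst hj; simp [select, flip, Function.update_of_ne h.symm]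
    · simp [select, flip, hj]
  have h3 := Equiv.sum_comp hflip.toPerm
    (fun x => parity S (select x y) * parity S (select x y'))
  simp only [Function.Involutive.coe_toPerm, h1, h2, neg_mul, Finset.sum_neg_distrib] at h3
  linarith

theorem card_agree_mul {ι β : Type} [Fintype ι] [DecidableEq ι] [Fintype β] [DecidableEq β]
    (S : Finset ι) (y : ι → β) :
    (Finset.univ.filter (fun y' : ι → β => ∀ i ∈ S, y i = y' i)).card * Fintype.card β ^ S.card =
      Fintype.card (ι → β) := by
  have h : Finset.univ.filter (fun y' : ι → β => ∀ i ∈ S, y i = y' i) =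
      Fintype.piFinset (fun i => if i ∈ S then {y i} else Finset.univ) := by
    ext y'
    simp only [Finset.mem_filter, Finset.mem_univ, true_and, Fintype.mem_piFinset]
    refine forall_congr' fun i => ?_
    by_cases hi : i ∈ S <;> simp [hi, eq_comm]
  have h2 : Fintype.card β ^ S.card = ∏ i, if i ∈ S then Fintype.card β else 1 := by
    rw [← Finset.prod_const, Finset.prod_ite_mem, Finset.univ_inter]
  rw [h, Fintype.card_piFinset, h2, ← Finset.prod_mul_distrib, Fintype.card_fun,
    ← Finset.card_univ (α := ι), ← Finset.prod_const]
  refine Finset.prod_congr rfl fun i _ => ?_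
  by_cases hi : i ∈ S <;> simp [hi]

/-- The unnormalized correlation of `Φ` with the parity of the selected bits in `S`. -/
noncomputable def corr {ι β : Type} [Fintype ι] [DecidableEq ι] [Fintype β] [DecidableEq β]
    (Φ : (ι → β → Bool) → (ι → β) → ℝ) (S : Finset ι) : ℝ :=
  ∑ x, ∑ y, Φ x y * parity S (select x y)

/-- The number of pairs `(x, y)`. -/
noncomputable def pairCount (ι β : Type) [Fintype ι] [DecidableEq ι] [Fintype β] [DecidableEq β] :
    ℝ := (Fintype.card (ι → β → Bool) : ℝ) * (Fintype.card (ι → β) : ℝ)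

/-- Cauchy–Schwarz over `x` removes `u`. After expanding the square, only pairs `y`, `y'` that agree
on `S` survive, a fraction `|β| ^ (-|S|)` of all pairs. -/
theorem corr_sq_mul_le {ι β : Type} [Fintype ι] [DecidableEq ι] [Fintype β] [DecidableEq β]
    (u : (ι → β → Bool) → ℝ) (v : (ι → β) → ℝ) (hu : ∀ x, |u x| ≤ 1) (hv : ∀ y, |v y| ≤ 1)
    (S : Finset ι) :
    corr (fun x y => u x * v y) S ^ 2 * (Fintype.card β : ℝ) ^ S.card ≤ pairCount ι β ^ 2 := by
  set X : ℝ := (Fintype.card (ι → β → Bool) : ℝ) with hX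
  set Y : ℝ := (Fintype.card (ι → β) : ℝ) with hY
  have h1 : corr (fun x y => u x * v y) S =
      ∑ x, u x * ∑ y, v y * parity S (select x y) := by
    refine Finset.sum_congr rfl fun x _ => ?_
    rw [Finset.mul_sum]
    exact Finset.sum_congr rfl fun y _ => by ring
  have h2 : ∑ x, u x ^ 2 ≤ X := by
    calc _ ≤ ∑ x : ι → β → Bool, (1 : ℝ) := Finset.sum_le_sum fun x _ => by
          rw [← sq_abs]; exact pow_le_one₀ (abs_nonneg _) (hu x)
      _ = X := by simp [hX]
  have h3 : ∑ x : ι → β → Bool, (∑ y, v y * parity S (select x y)) ^ 2 =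
      ∑ y, ∑ y', v y * v y' *
        ∑ x : ι → β → Bool, parity S (select x y) * parity S (select x y') := by
    simp only [sq, Finset.sum_mul_sum]
    rw [Finset.sum_comm]
    refine Finset.sum_congr rfl fun y _ => ?_
    rw [Finset.sum_comm]
    refine Finset.sum_congr rfl fun y' _ => ?_
    rw [Finset.mul_sum]
    exact Finset.sum_congr rfl fun x _ => by ring
  have h4 : ∀ y y' : ι → β, v y * v y' *
        ∑ x : ι → β → Bool, parity S (select x y) * parity S (select x y') ≤
      if ∀ i ∈ S, y i = y' i then X else 0 := by
    intro y y'
    split_ifs with h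
    · have : ∀ x : ι → β → Bool, parity S (select x y) * parity S (select x y') = 1 := by
        intro x
        rw [← parity_mul_self S (select x y)]
        congr 1
        exact Finset.prod_congr rfl fun i hi => by rw [select, select, h i hi]
      simp only [this, Finset.sum_const, Finset.card_univ, nsmul_eq_mul, mul_one, ← hX]
      have : v y * v y' ≤ 1 := by
        refine (le_abs_self _).trans ?_
        rw [abs_mul]
        exact mul_le_one₀ (hv y) (abs_nonneg _) (hv y')
      have hX0 : 0 ≤ X := by positivity
      nlinarith
    · push Not at h
      obtain ⟨i, hi, hne⟩ := h
      rw [sum_parity_mul_parity_eq_zero hi hne, mul_zero]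
  have h5 : (∑ x : ι → β → Bool, (∑ y, v y * parity S (select x y)) ^ 2) *
      (Fintype.card β : ℝ) ^ S.card ≤ X * Y ^ 2 := by
    rw [h3]
    calc _ ≤ (∑ y : ι → β, ∑ y' : ι → β, if ∀ i ∈ S, y i = y' i then X else 0) *
          (Fintype.card β : ℝ) ^ S.card := by
          gcongr with y _ y' _
          exact h4 y y'
      _ = ∑ y : ι → β, X * Y := by
          rw [Finset.sum_mul]
          refine Finset.sum_congr rfl fun y _ => ?_
          have := card_agree_mul S y
          rw [← Finset.sum_filter, Finset.sum_const, nsmul_eq_mul, hY, ← this]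
          push_cast; ring
      _ = X * Y ^ 2 := by
          rw [Finset.sum_const, Finset.card_univ, nsmul_eq_mul, ← hY]; ring
  have h6 : corr (fun x y => u x * v y) S ^ 2 ≤
      X * ∑ x : ι → β → Bool, (∑ y, v y * parity S (select x y)) ^ 2 := by
    rw [h1]
    refine (Finset.sum_mul_sq_le_sq_mul_sq _ _ _).trans ?_
    gcongr
  calc _ ≤ X * (∑ x : ι → β → Bool, (∑ y, v y * parity S (select x y)) ^ 2) *
        (Fintype.card β : ℝ) ^ S.card := by gcongr
    _ ≤ X * (X * Y ^ 2) := by rw [mul_assoc]; gcongr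
    _ = _ := by rw [pairCount]; ring

/-- `Φ` has correlation at most `R / B ^ k` with every parity of `k` selected bits. -/
def SmallCorr {ι β : Type} [Fintype ι] [DecidableEq ι] [Fintype β] [DecidableEq β]
    (B : ℕ) (R : ℝ) (Φ : (ι → β → Bool) → (ι → β) → ℝ) : Prop :=
  ∀ S : Finset ι, |corr Φ S| * (B : ℝ) ^ S.card ≤ R * pairCount ι β

theorem pairCount_nonneg (ι β : Type) [Fintype ι] [DecidableEq ι] [Fintype β] [DecidableEq β] :
    0 ≤ pairCount ι β := by unfold pairCount; positivity

section SmallCorr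
variable {ι β : Type} [Fintype ι] [DecidableEq ι] [Fintype β] [DecidableEq β] {B : ℕ}

theorem SmallCorr.mul_fun (hB : Fintype.card β = B ^ 2)
    {u : (ι → β → Bool) → ℝ} {v : (ι → β) → ℝ} (hu : ∀ x, |u x| ≤ 1) (hv : ∀ y, |v y| ≤ 1) :
    SmallCorr B 1 (fun x y => u x * v y) := by
  intro S
  have h := corr_sq_mul_le u v hu hv S
  rw [hB] at h
  rw [one_mul]
  refine abs_le_of_sq_le_sq' ?_ (pairCount_nonneg ι β) |>.2
  rw [mul_pow, sq_abs]
  refine le_trans (le_of_eq ?_) h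
  push_cast; ring

theorem SmallCorr.sum {κ : Type} (s : Finset κ) {R : κ → ℝ}
    {Φ : κ → (ι → β → Bool) → (ι → β) → ℝ} (h : ∀ k ∈ s, SmallCorr B (R k) (Φ k)) :
    SmallCorr B (∑ k ∈ s, R k) (fun x y => ∑ k ∈ s, Φ k x y) := by
  intro S
  have e : corr (fun x y => ∑ k ∈ s, Φ k x y) S = ∑ k ∈ s, corr (Φ k) S := by
    simp only [corr, Finset.sum_mul]
    rw [Finset.sum_comm]
    conv_rhs => rw [Finset.sum_comm]
    rw [Finset.sum_comm]
    refine Finset.sum_congr rfl fun x _ => ?_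
    rw [Finset.sum_comm]
  rw [e, Finset.sum_mul]
  calc _ ≤ (∑ k ∈ s, |corr (Φ k) S|) * (B : ℝ) ^ S.card := by
        gcongr; exact Finset.abs_sum_le_sum_abs _ _
    _ ≤ _ := by
        rw [Finset.sum_mul]
        exact Finset.sum_le_sum fun k hk => h k hk S

theorem SmallCorr.const_mul {R : ℝ} {Φ : (ι → β → Bool) → (ι → β) → ℝ} (h : SmallCorr B R Φ)
    (a : ℝ) : SmallCorr B (|a| * R) (fun x y => a * Φ x y) := by
  intro S
  have e : corr (fun x y => a * Φ x y) S = a * corr Φ S := by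
    simp only [corr, Finset.mul_sum, mul_assoc]
  rw [e, abs_mul, mul_assoc, mul_assoc]
  exact mul_le_mul_of_nonneg_left (h S) (abs_nonneg a)

theorem SmallCorr.add {R R' : ℝ} {Φ Φ' : (ι → β → Bool) → (ι → β) → ℝ} (h : SmallCorr B R Φ)
    (h' : SmallCorr B R' Φ') : SmallCorr B (R + R') (fun x y => Φ x y + Φ' x y) := by
  intro S
  have e : corr (fun x y => Φ x y + Φ' x y) S = corr Φ S + corr Φ' S := by
    simp only [corr, add_mul, Finset.sum_add_distrib]
  rw [e, add_mul]
  refine le_trans ?_ (add_le_add (h S) (h' S))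
  rw [← add_mul]
  gcongr
  exact abs_add_le _ _

theorem SmallCorr.mono {R R' : ℝ} {Φ : (ι → β → Bool) → (ι → β) → ℝ} (h : SmallCorr B R Φ)
    (hR : R ≤ R') : SmallCorr B R' Φ := fun S =>
  (h S).trans (mul_le_mul_of_nonneg_right hR (pairCount_nonneg ι β))

theorem SmallCorr.const (hB : Fintype.card β = B ^ 2) (a : ℝ) :
    SmallCorr B |a| (fun (_ : ι → β → Bool) (_ : ι → β) => a) := by
  have := (SmallCorr.mul_fun (ι := ι) hB (u := fun _ => 1) (v := fun _ => 1) (by simp)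
    (by simp)).const_mul a
  simpa using this

/-- A threshold gate whose left inputs contribute at most `A` in absolute value. -/
theorem SmallCorr.threshold (hB : Fintype.card β = B ^ 2) (A : ℕ) (t : ℤ)
    (α : (ι → β → Bool) → ℤ) (γ : (ι → β) → ℤ) (hα : ∀ x, |α x| ≤ A) :
    SmallCorr B (2 * A + 1) (fun x y => if t ≤ α x + γ y then 1 else 0) := by
  -- Splitting by the value `a` of `α x` writes the gate as `2 * A + 1` products of a function of
  -- `x` and a function of `y`; no bound on `γ` is needed.
  have h := SmallCorr.sum (Finset.Icc (-(A : ℤ)) A) (R := fun _ => 1) (fun a _ =>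
    SmallCorr.mul_fun (ι := ι) hB (u := fun x => if α x = a then 1 else 0)
      (v := fun y => if t ≤ a + γ y then 1 else 0) (fun x => by split_ifs <;> simp)
      (fun y => by split_ifs <;> simp))
  have e1 : ∑ _a ∈ Finset.Icc (-(A : ℤ)) A, (1 : ℝ) = 2 * A + 1 := by
    rw [Finset.sum_const, Int.card_Icc, nsmul_eq_mul, mul_one]
    have : ((A : ℤ) + 1 - -(A : ℤ)).toNat = 2 * A + 1 := by omega
    rw [this]; push_cast; ring
  rw [e1] at h
  convert h using 3 with x y
  rw [Finset.sum_eq_single (α x)]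
  · simp
  · intro a _ ha; simp [ha.symm]
  · intro hx
    exact absurd (Finset.mem_Icc.2 (abs_le.1 (hα x))) hx

end SmallCorr

/-! ### From correlation bounds to low-degree sign representations -/

/-- The product on the right is `2 ^ |ι|` times the indicator of `z = w`: Fourier inversion on the
cube. -/
theorem sum_parity_mul_parity {ι : Type} [Fintype ι] [DecidableEq ι] (z w : ι → Bool) :
    ∑ S : Finset ι, parity S z * parity S w = ∏ i, (1 + bitSign (z i) * bitSign (w i)) := by
  rw [Finset.prod_one_add, Finset.powerset_univ]
  simp only [parity, Finset.prod_mul_distrib]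

theorem prod_one_add_bitSign_nonneg {ι : Type} [Fintype ι] (z w : ι → Bool) :
    0 ≤ ∏ i, (1 + bitSign (z i) * bitSign (w i)) :=
  Finset.prod_nonneg fun i _ => by cases z i <;> cases w i <;> simp [bitSign]

theorem prod_one_add_bitSign_eq_zero {ι : Type} [Fintype ι] {z w : ι → Bool} (h : z ≠ w) :
    ∏ i, (1 + bitSign (z i) * bitSign (w i)) = 0 := by
  obtain ⟨i, hi⟩ := Function.ne_iff.1 h
  refine Finset.prod_eq_zero (Finset.mem_univ i) ?_
  cases hz : z i <;> cases hw : w i <;> simp_all [bitSign]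

theorem sum_bitSign_apply {β : Type} [Fintype β] [DecidableEq β] (a : β) :
    ∑ f : β → Bool, bitSign (f a) = 0 := by
  have h := sum_prod_bool (fun (j : β) b => if j = a then bitSign b else 1)
  have h1 : ∀ f : β → Bool, ∏ j, (if j = a then bitSign (f j) else 1) = bitSign (f a) := by
    intro f; simp
  simp only [h1] at h
  rw [h]
  exact Finset.prod_eq_zero (Finset.mem_univ a) (by simp [bitSign])

/-- For each fixed `y` the selected bits are uniform when `x` is, so the kernel has mean 1. -/
theorem sum_prod_one_add_bitSign_select {ι β : Type} [Fintype ι] [DecidableEq ι] [Fintype β]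
    [DecidableEq β] (z : ι → Bool) :
    ∑ x : ι → β → Bool, ∑ y : ι → β, ∏ i, (1 + bitSign (z i) * bitSign (select x y i)) =
      pairCount ι β := by
  have h : ∀ y : ι → β, ∑ x : ι → β → Bool, ∏ i, (1 + bitSign (z i) * bitSign (select x y i)) =
      (Fintype.card (ι → β → Bool) : ℝ) := by
    intro y
    have h1 := Finset.prod_univ_sum (fun _ : ι => (Finset.univ : Finset (β → Bool)))
      (fun i f => 1 + bitSign (z i) * bitSign (f (y i)))
    rw [Fintype.piFinset_univ] at h1
    simp only [select]
    rw [← h1]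
    have h2 : ∀ i, ∑ f : β → Bool, (1 + bitSign (z i) * bitSign (f (y i))) =
        (Fintype.card (β → Bool) : ℝ) := by
      intro i
      rw [Finset.sum_add_distrib, ← Finset.mul_sum, sum_bitSign_apply]
      simp
    rw [Finset.prod_congr rfl fun i _ => h2 i, Finset.prod_const, Finset.card_univ,
      Fintype.card_fun (α := ι)]
    push_cast; rfl
  rw [Finset.sum_comm, Finset.sum_congr rfl fun y _ => h y, Finset.sum_const, Finset.card_univ,
    nsmul_eq_mul, pairCount, mul_comm]

/-- Of the decay `n ^ (-2|S|)`, one factor `n ^ (-|S|)` yields `n ^ (-(d + 1))`; the other, summed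
over all sets, gives `(1 + 1/n) ^ n ≤ e`. -/
theorem sum_tail_le {ι : Type} [Fintype ι] (hn : 0 < Fintype.card ι) (d : ℕ) :
    ∑ S : Finset ι with ¬ S.card ≤ d, (((Fintype.card ι ^ 2 : ℕ) : ℝ) ^ S.card)⁻¹ ≤
      3 * ((Fintype.card ι : ℝ) ^ (d + 1))⁻¹ := by
  set n : ℝ := (Fintype.card ι : ℝ) with hnd
  have hn1 : 1 ≤ n := by rw [hnd]; exact_mod_cast hn
  have hn0 : 0 < n := by linarith
  calc _ ≤ ∑ S : Finset ι with ¬ S.card ≤ d, (n ^ (d + 1))⁻¹ * (n⁻¹) ^ S.card := by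
        refine Finset.sum_le_sum fun S hS => ?_
        have hS' : d + 1 ≤ S.card := by have := (Finset.mem_filter.1 hS).2; omega
        rw [inv_pow, ← mul_inv]
        refine inv_anti₀ (by positivity) ?_
        push_cast
        rw [← hnd, ← pow_mul, mul_comm 2, pow_mul, sq]
        gcongr
    _ ≤ ∑ S : Finset ι, (n ^ (d + 1))⁻¹ * (n⁻¹) ^ S.card :=
        Finset.sum_le_sum_of_subset_of_nonneg (Finset.filter_subset _ _)
          fun _ _ _ => by positivity
    _ = (n ^ (d + 1))⁻¹ * (n⁻¹ + 1) ^ Fintype.card ι := by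
        rw [← Finset.mul_sum, ← Fintype.sum_pow_mul_eq_add_pow]
        simp
    _ ≤ (n ^ (d + 1))⁻¹ * 3 := by
        gcongr
        calc _ ≤ (Real.exp n⁻¹) ^ Fintype.card ι := by
              gcongr; exact Real.add_one_le_exp _
          _ = Real.exp 1 := by
              rw [← Real.exp_nat_mul, ← hnd, mul_inv_cancel₀ hn0.ne']
          _ ≤ 3 := by have := Real.exp_one_lt_d9; linarith
    _ = _ := mul_comm _ _

theorem exists_lowDegree_of_smallCorr {ι β : Type} [Fintype ι] [DecidableEq ι] [Fintype β]
    [DecidableEq β] (hn : 0 < Fintype.card ι) (hβ : 0 < Fintype.card β)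
    {Φ : (ι → β → Bool) → (ι → β) → ℝ} {R : ℝ} {d : ℕ} {σ : (ι → Bool) → ℝ}
    (hcorr : SmallCorr (Fintype.card ι ^ 2) R Φ) (hR : 12 * R ≤ (Fintype.card ι : ℝ) ^ (d + 1))
    (hR0 : 0 ≤ R) (hσ : ∀ z, |σ z| = 1) (hsign : ∀ x y, 1 / 2 ≤ σ (select x y) * Φ x y)
    (habs : ∀ x y, |Φ x y| ≤ R) :
    ∃ c : Finset ι → ℝ, ∀ z, 1 / 4 ≤ σ z * lowDegree d c z ∧ |lowDegree d c z| ≤ R + 1 := by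
  have hP : 0 < pairCount ι β := by
    have : Nonempty β := Fintype.card_pos_iff.1 hβ
    have h1 : 0 < Fintype.card (ι → β → Bool) := Fintype.card_pos
    have h2 : 0 < Fintype.card (ι → β) := Fintype.card_pos
    unfold pairCount
    positivity
  let c : Finset ι → ℝ := fun S => corr Φ S / pairCount ι β
  let K : (ι → Bool) → (ι → Bool) → ℝ := fun z w => ∏ i, (1 + bitSign (z i) * bitSign (w i))
  refine ⟨c, fun z => ?_⟩
  -- The untruncated sum is the average of `Φ` over the pairs that select `z`; it inherits sign,
  -- margin and magnitude from `Φ`.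
  have hfull : (∑ S, c S * parity S z) * pairCount ι β =
      ∑ x, ∑ y, Φ x y * K z (select x y) := by
    have h1 : ∀ S, c S * parity S z * pairCount ι β = corr Φ S * parity S z := by
      intro S; simp only [c]; field_simp
    rw [Finset.sum_mul, Finset.sum_congr rfl fun S _ => h1 S]
    simp only [corr, Finset.sum_mul]
    rw [Finset.sum_comm]
    refine Finset.sum_congr rfl fun x _ => ?_
    rw [Finset.sum_comm]
    refine Finset.sum_congr rfl fun y _ => ?_
    simp only [K]
    rw [← sum_parity_mul_parity, Finset.mul_sum]
    exact Finset.sum_congr rfl fun S _ => by ring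
  have hK0 : ∀ w, 0 ≤ K z w := fun w => prod_one_add_bitSign_nonneg z w
  have hKsum := sum_prod_one_add_bitSign_select (β := β) z
  have hlow : 1 / 2 ≤ σ z * ∑ S, c S * parity S z := by
    refine le_of_mul_le_mul_right ?_ hP
    rw [mul_assoc, hfull, ← hKsum]
    simp only [Finset.mul_sum]
    refine Finset.sum_le_sum fun x _ => Finset.sum_le_sum fun y _ => ?_
    by_cases h : z = select x y
    · rw [← mul_assoc, h]
      exact mul_le_mul_of_nonneg_right (hsign x y) (prod_one_add_bitSign_nonneg _ _)
    · simp only [K, prod_one_add_bitSign_eq_zero h, mul_zero, le_refl]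
  have hup : |∑ S, c S * parity S z| ≤ R := by
    refine le_of_mul_le_mul_right ?_ hP
    rw [← abs_of_pos hP, ← abs_mul, abs_of_pos hP, hfull, ← hKsum, Finset.mul_sum]
    refine (Finset.abs_sum_le_sum_abs _ _).trans (Finset.sum_le_sum fun x _ => ?_)
    rw [Finset.mul_sum]
    refine (Finset.abs_sum_le_sum_abs _ _).trans (Finset.sum_le_sum fun y _ => ?_)
    rw [abs_mul, abs_of_nonneg (hK0 _)]
    exact mul_le_mul_of_nonneg_right (habs x y) (hK0 _)
  have hsplit : ∑ S, c S * parity S z = lowDegree d c z +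
      ∑ S : Finset ι with ¬ S.card ≤ d, c S * parity S z := by
    rw [lowDegree, Finset.sum_filter_add_sum_filter_not]
  have htail : |∑ S : Finset ι with ¬ S.card ≤ d, c S * parity S z| ≤ 1 / 4 := by
    have hn' : 0 < (Fintype.card ι : ℝ) := by exact_mod_cast hn
    calc _ ≤ ∑ S : Finset ι with ¬ S.card ≤ d,
          R * (((Fintype.card ι ^ 2 : ℕ) : ℝ) ^ S.card)⁻¹ := by
          refine (Finset.abs_sum_le_sum_abs _ _).trans (Finset.sum_le_sum fun S _ => ?_)
          rw [abs_mul, abs_parity, mul_one, abs_div, abs_of_pos hP, div_le_iff₀ hP]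
          have h := hcorr S
          have hpos : 0 < (((Fintype.card ι ^ 2 : ℕ) : ℝ) ^ S.card) := by positivity
          rw [mul_right_comm, ← div_eq_mul_inv, le_div_iff₀ hpos]
          exact h
      _ ≤ R * (3 * ((Fintype.card ι : ℝ) ^ (d + 1))⁻¹) := by
          rw [← Finset.mul_sum]
          gcongr
          exact sum_tail_le hn d
      _ ≤ 1 / 4 := by
          rw [← mul_assoc, ← div_eq_mul_inv, div_le_iff₀ (by positivity)]
          linarith
  set T := ∑ S : Finset ι with ¬ S.card ≤ d, c S * parity S z
  rw [hsplit] at hlow hup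
  constructor
  · have : |σ z * T| ≤ 1 / 4 := by rw [abs_mul, hσ, one_mul]; exact htail
    have := (abs_le.1 this).2
    linarith
  · have h2 : |lowDegree d c z| ≤ |lowDegree d c z + T| + |T| := by
      have := abs_sub (lowDegree d c z + T) T
      simpa using this
    linarith

/-! ### Depth-two circuits have small correlation -/

/-- The value of a literal as an integer. -/
def Literal.bit {κ : Type} (z : κ → Bool) (l : Literal κ) : ℤ := if Literal.value z l then 1 else 0

/-- A literal reads only one of the two sides. The subtracted term compensates for constants and for
negated variables read as 1 on the zeroed side. -/
theorem Literal.bit_sumElim {κ κ' : Type} (u : κ → Bool) (v : κ' → Bool) (l : Literal (κ ⊕ κ')) :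
    Literal.bit (Sum.elim u v) l = Literal.bit (Sum.elim u fun _ => false) l +
      (Literal.bit (Sum.elim (fun _ => false) v) l -
        Literal.bit (Sum.elim (fun _ => false) fun _ => false) l) := by
  rcases l with (i | i) | (i | i) | b <;> simp [Literal.bit, Literal.value] <;>
    split_ifs <;> simp_all

theorem abs_sum_mul_bit_le {κ : Type} (s : Finset κ) (w : κ → ℤ) (W : ℕ) (hw : ∀ j, |w j| ≤ W)
    (p : κ → Prop) [DecidablePred p] :
    |∑ j ∈ s, w j * (if p j then 1 else 0)| ≤ ((s.card * W : ℕ) : ℤ) := by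
  refine (Finset.abs_sum_le_sum_abs _ _).trans ?_
  calc _ ≤ ∑ j ∈ s, (W : ℤ) := by
        refine Finset.sum_le_sum fun j _ => ?_
        split_ifs <;> simp [hw j]
    _ = _ := by simp

/-- The correlation and magnitude bound for circuits with at most `s` bottom gates, weights at most
`W`, and `l` literals. -/
def circuitBound (s W l : ℕ) : ℕ := s * W * (2 * (l * W) + 1) + (s * W + 1)

theorem DepthTwoCircuit.exists_smallCorr {ι β κ κ' : Type} [Fintype ι] [DecidableEq ι] [Fintype β]
    [DecidableEq β] [Fintype κ] [Fintype κ'] {B : ℕ} (hB : Fintype.card β = B ^ 2)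
    (C : DepthTwoCircuit (κ ⊕ κ')) {s W : ℕ} (hs : C.s ≤ s) (hW : C.WeightLE W)
    (htrue : ∃ z, C.eval z = true) (hfalse : ∃ z, C.eval z = false)
    (X : (ι → β → Bool) → κ → Bool) (Y : (ι → β) → κ' → Bool) :
    ∃ Φ : (ι → β → Bool) → (ι → β) → ℝ,
      SmallCorr B (circuitBound s W (Fintype.card (Literal (κ ⊕ κ')))) Φ ∧
      (∀ x y, |Φ x y| ≤ circuitBound s W (Fintype.card (Literal (κ ⊕ κ')))) ∧
      ∀ x y, 1 / 2 ≤ (if C.eval (Sum.elim (X x) (Y y)) then 1 else -1) * Φ x y := by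
  obtain ⟨hWt, hWb⟩ := hW
  set l := Fintype.card (Literal (κ ⊕ κ')) with hl
  let G : Fin C.s → (κ ⊕ κ' → Bool) → Prop := fun j z =>
    (C.bottom j).threshold ≤ ∑ i, (C.bottom j).weight i * Literal.bit z i
  have hG : ∀ j z, (C.bottom j).eval (fun i => Literal.value z i) = true ↔ G j z := by
    intro j z
    simp [ThresholdGate.eval, G, Literal.bit]
  classical
  let V : (κ ⊕ κ' → Bool) → ℤ := fun z => ∑ j, C.top.weight j * (if G j z then 1 else 0)
  have heval : ∀ z, C.eval z = true ↔ C.top.threshold ≤ V z := by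
    intro z
    simp only [DepthTwoCircuit.eval, V]
    rw [ThresholdGate.eval, decide_eq_true_iff]
    simp only [hG]
  have hsW : C.s * W ≤ s * W := Nat.mul_le_mul_right _ hs
  have hV : ∀ z, |V z| ≤ ((s * W : ℕ) : ℤ) := by
    intro z
    refine (abs_sum_mul_bit_le Finset.univ C.top.weight W hWt (fun j => G j z)).trans ?_
    simp only [Finset.card_univ, Fintype.card_fin]
    exact_mod_cast hsW
  -- `WeightLE` does not control thresholds; the top one is bounded because both output values
  -- occur.
  have hθ : |C.top.threshold| ≤ ((s * W : ℕ) : ℤ) := by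
    obtain ⟨z, hz⟩ := htrue
    obtain ⟨z', hz'⟩ := hfalse
    have h1 := (heval z).1 hz
    have h2 : ¬ C.top.threshold ≤ V z' := by rw [← heval, hz']; simp
    have h3 := abs_le.1 (hV z)
    have h4 := abs_le.1 (hV z')
    rw [abs_le]; constructor <;> omega
  -- The half turns the integer comparison with the threshold into a sign with margin 1/2 on both
  -- sides.
  let a : ℝ := 1 / 2 - (C.top.threshold : ℝ)
  have hθ' : |(C.top.threshold : ℝ)| ≤ ((s * W : ℕ) : ℝ) := by
    have : ((|C.top.threshold| : ℤ) : ℝ) ≤ (((s * W : ℕ) : ℤ) : ℝ) := by exact_mod_cast hθ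
    rwa [Int.cast_abs, Int.cast_natCast] at this
  have ha : |a| ≤ ((s * W : ℕ) : ℝ) + 1 := by
    rw [abs_le] at hθ' ⊢
    simp only [a]
    constructor <;> linarith
  have hV' : ∀ z, |(V z : ℝ)| ≤ ((s * W : ℕ) : ℝ) := by
    intro z
    have : ((|V z| : ℤ) : ℝ) ≤ (((s * W : ℕ) : ℤ) : ℝ) := by exact_mod_cast hV z
    rwa [Int.cast_abs, Int.cast_natCast] at this
  have hbound : (circuitBound s W l : ℝ) =
      ((s * W : ℕ) : ℝ) * (2 * ((l * W : ℕ) : ℝ) + 1) + (((s * W : ℕ) : ℝ) + 1) := by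
    simp only [circuitBound]; push_cast; ring
  refine ⟨fun x y => (V (Sum.elim (X x) (Y y)) : ℝ) + a, ?_, fun x y => ?_, fun x y => ?_⟩
  · have hgate : ∀ j, SmallCorr (ι := ι) (β := β) B (2 * ((l * W : ℕ) : ℝ) + 1)
        (fun x y => if G j (Sum.elim (X x) (Y y)) then 1 else 0) := by
      intro j
      have h := SmallCorr.threshold (ι := ι) hB (l * W) (C.bottom j).threshold
        (fun x => ∑ i, (C.bottom j).weight i * Literal.bit (Sum.elim (X x) fun _ => false) i)
        (fun y => ∑ i, (C.bottom j).weight i *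
          (Literal.bit (Sum.elim (fun _ => false) (Y y)) i -
            Literal.bit (Sum.elim (fun _ => false) fun _ => false) i))
        (fun x => abs_sum_mul_bit_le Finset.univ _ W (hWb j) _)
      convert h using 4 with x y
      simp only [G]
      rw [← Finset.sum_add_distrib]
      simp only [← mul_add, ← Literal.bit_sumElim]
    have h := (SmallCorr.sum Finset.univ fun j _ =>
      (hgate j).const_mul (C.top.weight j : ℝ)).add (SmallCorr.const (ι := ι) hB a)
    have h' := h.mono (R' := circuitBound s W l) (by
      rw [hbound]
      refine add_le_add ?_ ha
      rw [← Finset.sum_mul]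
      gcongr
      calc ∑ j, |(C.top.weight j : ℝ)| ≤ ∑ _j : Fin C.s, (W : ℝ) :=
            Finset.sum_le_sum fun j _ => by
              have : ((|C.top.weight j| : ℤ) : ℝ) ≤ ((W : ℤ) : ℝ) := by exact_mod_cast hWt j
              rwa [Int.cast_abs, Int.cast_natCast] at this
        _ = ((C.s * W : ℕ) : ℝ) := by simp
        _ ≤ _ := by exact_mod_cast hsW)
    convert h' using 3 with x y
    simp only [V]
    push_cast
    rfl
  · rw [hbound]
    refine (abs_add_le _ _).trans (add_le_add ((hV' _).trans ?_) ha)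
    refine le_mul_of_one_le_right (by positivity) ?_
    have : (0 : ℝ) ≤ ((l * W : ℕ) : ℝ) := by positivity
    linarith
  · by_cases h : C.eval (Sum.elim (X x) (Y y)) = true
    · have h1 := (heval _).1 h
      have h2 : (C.top.threshold : ℝ) ≤ V (Sum.elim (X x) (Y y)) := by exact_mod_cast h1
      rw [if_pos h]
      simp only [a]; linarith
    · have h1 : V (Sum.elim (X x) (Y y)) + 1 ≤ C.top.threshold := by
        have := mt (heval (Sum.elim (X x) (Y y))).2 h
        omega
      have h2 : (V (Sum.elim (X x) (Y y)) : ℝ) + 1 ≤ C.top.threshold := by exact_mod_cast h1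
      rw [if_neg h]
      simp only [a]; linarith

/-! ### Odd-max-bit of levels of selected bits inside `OMB ∘ AND₂` -/

/-- The parity of the highest level (counted from 1) that holds a 1. -/
def levelOmb {L m : ℕ} (z : Fin L × Fin m → Bool) : Bool :=
  decide ((Finset.univ.filter (fun i => z i = true)).sup (fun i => (i.1 : ℕ) + 1) % 2 = 1)

theorem levelOmb_false {L m : ℕ} : levelOmb (fun _ : Fin L × Fin m => false) = false := by
  simp [levelOmb]

theorem levelOmb_of_top {L m : ℕ} {z : Fin L × Fin m → Bool} {k : Fin L}
    (h : ∃ j, z (k, j) = true) (h' : ∀ l, k < l → ∀ j, z (l, j) = false) :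
    levelOmb z = decide (((k : ℕ) + 1) % 2 = 1) := by
  have : (Finset.univ.filter (fun i => z i = true)).sup (fun i => (i.1 : ℕ) + 1) = k + 1 := by
    obtain ⟨j, hj⟩ := h
    refine le_antisymm (Finset.sup_le fun i hi => ?_) ?_
    · by_contra hcon
      have := h' i.1 (by rw [Fin.lt_def]; omega) i.2
      simp_all
    · exact Finset.le_sup (f := fun i : Fin L × Fin m => (i.1 : ℕ) + 1) (b := (k, j)) (by simpa using hj)
  rw [levelOmb, this]

/-- An enumeration of the selectable bits in which higher levels come later. -/
def bitIndex {L m b : ℕ} : ((Fin L × Fin m) × Fin b) ≃ Fin (L * m * b) :=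
  (finProdFinEquiv.prodCongr (Equiv.refl _)).trans finProdFinEquiv

theorem bitIndex_val {L m b : ℕ} (i : Fin L × Fin m) (a : Fin b) :
    (bitIndex (i, a) : ℕ) = a + b * (i.2 + m * i.1) := by
  simp [bitIndex, finProdFinEquiv]

theorem bitIndex_lt {L m b : ℕ} {i i' : Fin L × Fin m} (h : i.1 < i'.1) (a a' : Fin b) :
    (bitIndex (i, a) : ℕ) < bitIndex (i', a') := by
  rw [bitIndex_val, bitIndex_val]
  have h1 : (i.1 : ℕ) + 1 ≤ i'.1 := h
  have h2 : (i.2 : ℕ) + m * i.1 + 1 ≤ i'.2 + m * i'.1 := by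
    have := Nat.mul_le_mul_left m h1
    have := i.2.2
    rw [mul_add] at *
    omega
  have := Nat.mul_le_mul_left b h2
  rw [mul_add] at this
  have := a.2
  omega

/-- The position of a selectable bit in `OMB ∘ AND₂`, chosen with the parity of the level. -/
def bitPos {L m b : ℕ} (i : Fin L × Fin m) (a : Fin b) : Fin (2 * (L * m * b)) :=
  ⟨2 * (bitIndex (i, a) : ℕ) + (i.1 : ℕ) % 2, by
    have := (bitIndex (i, a)).2
    omega⟩

theorem bitPos_inj {L m b : ℕ} {i i' : Fin L × Fin m} {a a' : Fin b}
    (h : bitPos i a = bitPos i' a') : i = i' ∧ a = a' := by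
  have h1 := congrArg Fin.val h
  simp only [bitPos] at h1
  have h2 : bitIndex (i, a) = bitIndex (i', a') := Fin.ext (by omega)
  exact Prod.ext_iff.1 (bitIndex.injective h2)

open Classical in
/-- The left input of `OMB ∘ AND₂` that holds the bits of `x`. -/
noncomputable def leftInput {L m b : ℕ} (x : Fin L × Fin m → Fin b → Bool) :
    Fin (2 * (L * m * b)) → Bool :=
  fun q => decide (∃ i a, bitPos i a = q ∧ x i a = true)

open Classical in
/-- The right input of `OMB ∘ AND₂` that holds the characteristic vector of the selection `y`. -/
noncomputable def rightInput {L m b : ℕ} (y : Fin L × Fin m → Fin b) :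
    Fin (2 * (L * m * b)) → Bool :=
  fun q => decide (∃ i, bitPos i (y i) = q)

theorem leftInput_and_rightInput {L m b : ℕ} (x : Fin L × Fin m → Fin b → Bool)
    (y : Fin L × Fin m → Fin b) (q : Fin (2 * (L * m * b))) :
    (leftInput x q && rightInput y q) = true ↔ ∃ i, bitPos i (y i) = q ∧ select x y i = true := by
  simp only [leftInput, rightInput, Bool.and_eq_true, decide_eq_true_eq]
  constructor
  · rintro ⟨⟨i, a, rfl, hx⟩, i', h⟩
    obtain ⟨rfl, rfl⟩ := bitPos_inj h
    exact ⟨i', rfl, hx⟩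
  · rintro ⟨i, rfl, hx⟩
    exact ⟨⟨i, y i, rfl, hx⟩, i, rfl⟩

/-- Positions increase with the level, so the last satisfied conjunction lies in the top nonzero
level, and its position has the parity of that level. -/
theorem ombAnd2_leftInput_rightInput {L m b : ℕ} (x : Fin L × Fin m → Fin b → Bool)
    (y : Fin L × Fin m → Fin b) :
    ombAnd2 (2 * (L * m * b)) (Sum.elim (leftInput x) (rightInput y)) = levelOmb (select x y) := by
  simp only [ombAnd2, omb, levelOmb, Sum.elim_inl, Sum.elim_inr, leftInput_and_rightInput]
  rw [decide_eq_decide]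
  set Z := Finset.univ.filter (fun i => select x y i = true) with hZ
  set Q := Finset.univ.filter (fun q => ∃ i, bitPos i (y i) = q ∧ select x y i = true) with hQ
  have hmem : ∀ i, i ∈ Z → bitPos i (y i) ∈ Q := by
    intro i hi
    simp only [hQ, hZ, Finset.mem_filter, Finset.mem_univ, true_and] at hi ⊢
    exact ⟨i, rfl, hi⟩
  have hmem' : ∀ q, q ∈ Q → ∃ i ∈ Z, bitPos i (y i) = q := by
    intro q hq
    simp only [hQ, hZ, Finset.mem_filter, Finset.mem_univ, true_and] at hq ⊢
    obtain ⟨i, h1, h2⟩ := hq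
    exact ⟨i, h2, h1⟩
  rcases Z.eq_empty_or_nonempty with h0 | h0
  · have h1 : Q = ∅ := by
      rw [Finset.eq_empty_iff_forall_notMem]
      intro q hq
      obtain ⟨i, hi, -⟩ := hmem' q hq
      simp [h0] at hi
    simp [h0, h1]
  · have hQne : Q.Nonempty := by
      obtain ⟨i, hi⟩ := h0
      exact ⟨_, hmem i hi⟩
    obtain ⟨i, hi, hisup⟩ := Finset.exists_mem_eq_sup Z h0 (fun i => (i.1 : ℕ) + 1)
    obtain ⟨q, hq, hqsup⟩ := Finset.exists_mem_eq_sup Q hQne (fun q => (q : ℕ) + 1)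
    obtain ⟨i', hi', rfl⟩ := hmem' q hq
    have h1 : (i'.1 : ℕ) + 1 ≤ i.1 + 1 := by
      rw [← hisup]; exact Finset.le_sup (f := fun i : Fin L × Fin m => (i.1 : ℕ) + 1) hi'
    have h2 : (bitPos i (y i) : ℕ) + 1 ≤ bitPos i' (y i') + 1 := by
      rw [← hqsup]
      exact Finset.le_sup (f := fun q : Fin (2 * (L * m * b)) => (q : ℕ) + 1) (hmem i hi)
    have h3 : (i.1 : ℕ) ≤ i'.1 := by
      by_contra hcon
      have := bitIndex_lt (i := i') (i' := i) (by rw [Fin.lt_def]; omega) (y i') (y i)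
      simp only [bitPos] at h2
      omega
    rw [hisup, hqsup]
    simp only [bitPos]
    omega

/-! ### The lower bound for depth-two circuits -/

theorem exists_eval_le_pow (p : Polynomial ℕ) : ∃ c : ℕ, ∀ x : ℕ, 2 ≤ x → p.eval x ≤ x ^ c := by
  induction p using Polynomial.induction_on' with
  | add p q hp hq =>
    obtain ⟨c, hc⟩ := hp
    obtain ⟨c', hc'⟩ := hq
    refine ⟨max c c' + 1, fun x hx => ?_⟩
    have h1 : x ^ c ≤ x ^ max c c' := Nat.pow_le_pow_right (by omega) (le_max_left _ _)
    have h2 : x ^ c' ≤ x ^ max c c' := Nat.pow_le_pow_right (by omega) (le_max_right _ _)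
    have h3 := hc x hx
    have h4 := hc' x hx
    rw [Polynomial.eval_add, pow_succ]
    nlinarith
  | monomial n a =>
    refine ⟨a + n, fun x hx => ?_⟩
    rw [Polynomial.eval_monomial, pow_add]
    gcongr
    exact Nat.lt_two_pow_self.le.trans (Nat.pow_le_pow_left hx a)

theorem exists_mul_pow_lt_two_pow (m e : ℕ) : ∃ L : ℕ, 2 ≤ L ∧ 8 * (L * m) ^ e < 2 ^ L := by
  have h := tendsto_pow_const_div_const_pow_of_one_lt e (one_lt_two (α := ℝ))
  have hpos : (0 : ℝ) < 1 / (8 * (m : ℝ) ^ e + 1) := by positivity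
  obtain ⟨L, hL, hL2⟩ := ((h.eventually_lt_const hpos).and (Filter.eventually_ge_atTop 2)).exists
  refine ⟨L, hL2, ?_⟩
  rw [div_lt_div_iff₀ (by positivity) (by positivity), one_mul] at hL
  have h1 : (0 : ℝ) ≤ (L : ℝ) ^ e := by positivity
  have h2 : 8 * ((L : ℝ) * m) ^ e < 2 ^ L := by rw [mul_pow]; nlinarith
  exact_mod_cast h2

theorem DepthTwoCircuit.WeightLE.mono {κ : Type} {C : DepthTwoCircuit κ} {W W' : ℕ}
    (h : C.WeightLE W) (hW : W ≤ W') : C.WeightLE W' :=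
  ⟨fun j => (h.1 j).trans (by exact_mod_cast hW), fun j l => (h.2 j l).trans (by exact_mod_cast hW)⟩

theorem circuitBound_le {n c : ℕ} (hn : 2 ≤ n) :
    circuitBound (n ^ (7 * c)) (n ^ (7 * c)) (8 * n ^ 5 + 2) ≤ n ^ (21 * c + 11) := by
  set Q := n ^ (7 * c) with hQ
  have hQ1 : 1 ≤ Q := Nat.one_le_pow _ _ (by omega)
  have e : n ^ (21 * c + 11) = Q ^ 3 * n ^ 11 := by rw [hQ, ← pow_mul, ← pow_add]; ring_nf
  have h5 : 1 ≤ n ^ 5 := Nat.one_le_pow _ _ (by omega)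
  have h6 : 2 ^ 6 ≤ n ^ 6 := Nat.pow_le_pow_left hn 6
  have h11 : 16 * n ^ 5 + 7 ≤ n ^ 11 := by
    rw [show n ^ 11 = n ^ 5 * n ^ 6 by ring]; nlinarith
  have hQ2 : Q ^ 2 ≤ Q ^ 3 := Nat.pow_le_pow_right hQ1 (by norm_num)
  have hQ3 : 1 ≤ Q ^ 3 := Nat.one_le_pow _ _ hQ1
  rw [e, circuitBound]
  calc _ = Q ^ 3 * (16 * n ^ 5 + 4) + Q ^ 2 + Q ^ 2 + 1 := by ring
    _ ≤ Q ^ 3 * (16 * n ^ 5 + 7) := by nlinarith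
    _ ≤ _ := Nat.mul_le_mul_left _ h11

theorem ombAnd2_notMem_MAJMAJ : ombAnd2 ∉ MAJMAJ (fun n => Fin n ⊕ Fin n) := by
  rintro ⟨p, hp⟩
  obtain ⟨c, hc⟩ := exists_eval_le_pow p
  -- The circuit bound will be at most `n ^ (21 * c + 11)`; three more in the degree give `n ^ 4 ≥
  -- 12` of room in `12 * R ≤ n ^ (d + 1)`.
  obtain ⟨m, hm, hext⟩ := exists_nat_eval_ge (21 * c + 14) (1 / 8) (by norm_num)
  obtain ⟨L, hL2, hL⟩ := exists_mul_pow_lt_two_pow m (21 * c + 11)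
  set n := L * m with hn
  have hn2 : 2 ≤ n := by nlinarith
  have hcard : Fintype.card (Fin L × Fin m) = n := by simp [hn]
  -- Correlation decays like `b ^ (-|S|/2)`; this `b` gives the base `n ^ 2` needed for the tail
  -- bound.
  set b := (n ^ 2) ^ 2 with hb
  have hb0 : 0 < b := by positivity
  obtain ⟨C, hsize, hW, hC⟩ := hp (2 * (L * m * b))
  have hvars : Fintype.card (Fin (2 * (L * m * b)) ⊕ Fin (2 * (L * m * b))) = 4 * n ^ 5 := by
    simp only [Fintype.card_sum, Fintype.card_fin, ← hn, hb]; ring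
  have hlits : Fintype.card (Literal (Fin (2 * (L * m * b)) ⊕ Fin (2 * (L * m * b)))) =
      8 * n ^ 5 + 2 := by
    simp only [Fintype.card_sum, Fintype.card_fin, Fintype.card_bool, ← hn, hb]; ring
  have hQ : p.eval (4 * n ^ 5) ≤ n ^ (7 * c) := by
    have h5 : 1 ≤ n ^ 5 := Nat.one_le_pow _ _ (by omega)
    refine (hc _ (by omega)).trans ?_
    rw [pow_mul]
    refine Nat.pow_le_pow_left ?_ c
    rw [show n ^ 7 = n ^ 2 * n ^ 5 by ring]
    exact Nat.mul_le_mul_right _ (by nlinarith)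
  rw [hvars] at hsize hW
  have hs : C.s ≤ n ^ (7 * c) := by
    rw [DepthTwoCircuit.size] at hsize; omega
  let y₀ : Fin L × Fin m → Fin b := fun _ => ⟨0, hb0⟩
  have heval : ∀ x y, C.eval (Sum.elim (leftInput x) (rightInput y)) = levelOmb (select x y) := by
    intro x y; rw [hC, ombAnd2_leftInput_rightInput]
  obtain ⟨Φ, hcorr, habs, hsign⟩ := C.exists_smallCorr (ι := Fin L × Fin m) (β := Fin b)
    (B := n ^ 2) (by rw [Fintype.card_fin]) hs (hW.mono hQ)
    ⟨_, (heval (fun i _ => decide ((i.1 : ℕ) = 0)) y₀).trans (levelOmb_of_top (k := ⟨0, by omega⟩)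
      ⟨⟨0, hm⟩, by simp [select]⟩ (fun l hl j => by
        have : (l : ℕ) ≠ 0 := by rw [Fin.lt_def] at hl; simp at hl; omega
        simp [select, this]))⟩
    ⟨_, (heval (fun _ _ => false) y₀).trans levelOmb_false⟩ leftInput rightInput
  rw [hlits] at hcorr habs
  have hRle := circuitBound_le (c := c) hn2
  set R := circuitBound (n ^ (7 * c)) (n ^ (7 * c)) (8 * n ^ 5 + 2)
  obtain ⟨q, hq⟩ := exists_lowDegree_of_smallCorr (ι := Fin L × Fin m) (β := Fin b) (Φ := Φ)
    (R := R) (d := 21 * c + 14) (σ := fun z => if levelOmb z then 1 else -1)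
    (by omega) (by rw [Fintype.card_fin]; exact hb0) (by rwa [hcard])
    (by
      rw [hcard]
      have h1 : 12 * R ≤ n ^ (21 * c + 14 + 1) := by
        rw [show 21 * c + 14 + 1 = 21 * c + 11 + 4 by ring, pow_add _ _ 4]
        have : 2 ^ 4 ≤ n ^ 4 := Nat.pow_le_pow_left hn2 4
        nlinarith
      exact_mod_cast h1)
    (by positivity) (fun z => by split_ifs <;> simp)
    (fun x y => by have := hsign x y; rwa [heval] at this) habs
  obtain ⟨z, hz⟩ := exists_two_pow_le_abs_lowDegree (hext) L q
    (by have := (hq fun _ => false).1; rw [levelOmb_false] at this; simp at this; linarith)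
    (fun z k h h' => by
      have := (hq z).1
      rw [levelOmb_of_top h h'] at this
      rcases Nat.even_or_odd (k : ℕ) with hk | hk
      · have e : ((k : ℕ) + 1) % 2 = 1 := by have := Nat.even_iff.1 hk; omega
        rw [hk.neg_one_pow]
        simpa [e] using this
      · have e : ¬ ((k : ℕ) + 1) % 2 = 1 := by have := Nat.odd_iff.1 hk; omega
        rw [hk.neg_one_pow]
        simpa [e] using this)
  have h1 := hz.trans (hq z).2
  have h2 : 2 ^ L ≤ 4 * (R + 1) := by
    have : (2 : ℝ) ^ L ≤ 4 * (R + 1) := by linarith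
    exact_mod_cast this
  have h3 : 1 ≤ n ^ (21 * c + 11) := Nat.one_le_pow _ _ (by omega)
  omega

/-! ### `MAJ ∘ MAJ` is closed under substitutions -/

/-- The literal that a substitution puts in place of a literal. -/
def Literal.subst {ι κ : Type} (v : κ → ι ⊕ Bool) : Literal κ → Literal ι :=
  Sum.elim (fun j => Sum.elim Sum.inl (fun b => Sum.inr (Sum.inr b)) (v j))
    (Sum.elim (fun j => Sum.elim (fun i => Sum.inr (Sum.inl i)) (fun b => Sum.inr (Sum.inr !b))
      (v j)) (fun b => Sum.inr (Sum.inr b)))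

theorem Literal.value_subst {ι κ : Type} (v : κ → ι ⊕ Bool) (x : ι → Bool) (l : Literal κ) :
    Literal.value x (Literal.subst v l) = Literal.value (fun j => Sum.elim x id (v j)) l := by
  rcases l with j | j | b
  · cases h : v j <;> simp [Literal.subst, Literal.value, h]
  · cases h : v j <;> simp [Literal.subst, Literal.value, h]
  · simp [Literal.subst, Literal.value]

/-- Different literals may be substituted by the same one, and their weights then add up; the
summand `W` covers the unchanged top gate. -/
theorem DepthTwoCircuit.exists_of_isSubfunction {ι κ : Type} [Fintype ι] [Fintype κ]
    {f : BoolFn ι} (C : DepthTwoCircuit κ) {W : ℕ} (hW : C.WeightLE W)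
    (h : IsSubfunction f C.eval) :
    ∃ C' : DepthTwoCircuit ι, C'.size = C.size ∧
      C'.WeightLE (Fintype.card (Literal κ) * W + W) ∧ C'.eval = f := by
  classical
  obtain ⟨v, hv⟩ := h
  refine ⟨⟨C.s, fun j => ⟨fun l => ∑ l' with Literal.subst v l' = l, (C.bottom j).weight l',
    (C.bottom j).threshold⟩, C.top⟩, rfl, ⟨fun j => ?_, fun j l => ?_⟩, ?_⟩
  · refine (hW.1 j).trans ?_
    push_cast
    exact le_add_of_nonneg_left (by positivity)
  · refine (Finset.abs_sum_le_sum_abs _ _).trans ?_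
    calc _ ≤ ∑ l' : Literal κ, |(C.bottom j).weight l'| :=
          Finset.sum_le_sum_of_subset_of_nonneg (Finset.filter_subset _ _)
            fun _ _ _ => abs_nonneg _
      _ ≤ ∑ _l' : Literal κ, (W : ℤ) := Finset.sum_le_sum fun l' _ => hW.2 j l'
      _ = ((Fintype.card (Literal κ) * W : ℕ) : ℤ) := by
          rw [Finset.sum_const, Finset.card_univ, nsmul_eq_mul, Nat.cast_mul]
      _ ≤ _ := by push_cast; exact le_add_of_nonneg_right (by positivity)
  · funext x
    rw [hv]
    have hsum : ∀ j, ∑ l, (∑ l' with Literal.subst v l' = l, (C.bottom j).weight l') *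
          (if Literal.value x l then 1 else 0) =
        ∑ l', (C.bottom j).weight l' *
          (if Literal.value (fun j => Sum.elim x id (v j)) l' then 1 else 0) := by
      intro j
      rw [← Finset.sum_fiberwise Finset.univ (Literal.subst v)]
      refine Finset.sum_congr rfl fun l _ => ?_
      rw [Finset.sum_mul]
      refine Finset.sum_congr rfl fun l' hl' => ?_
      rw [← Literal.value_subst, (Finset.mem_filter.1 hl').2]
    simp only [DepthTwoCircuit.eval, ThresholdGate.eval, hsum]

theorem eval_mono (p : Polynomial ℕ) : Monotone fun x => p.eval x := by
  intro x y h
  simp only [Polynomial.eval_eq_sum, Polynomial.sum]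
  gcongr

theorem mem_MAJMAJ_of_isSubfunction {ι : ℕ → Type} [∀ k, Fintype (ι k)] {f : BoolFamily ι}
    {g : BoolFamily Fin} (hg : g ∈ MAJMAJ Fin) (p : Polynomial ℕ)
    (h : ∀ k, ∃ m ≤ p.eval (Fintype.card (ι k)), IsSubfunction (f k) (g m)) :
    f ∈ MAJMAJ ι := by
  obtain ⟨q, hq⟩ := hg
  refine ⟨(2 * p + 3) * q.comp p, fun k => ?_⟩
  obtain ⟨m, hm, hsub⟩ := h k
  obtain ⟨C, hsize, hW, hC⟩ := hq m
  rw [Fintype.card_fin] at hsize hW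
  have hle : q.eval m ≤ q.eval (p.eval (Fintype.card (ι k))) := eval_mono q hm
  rw [← hC] at hsub
  obtain ⟨C', h1, h2, h3⟩ := C.exists_of_isSubfunction hW hsub
  have h4 : Fintype.card (Literal (Fin m)) = 2 * m + 2 := by
    simp only [Fintype.card_sum, Fintype.card_fin, Fintype.card_bool]; ring
  have h5 : ((2 * p + 3) * q.comp p).eval (Fintype.card (ι k)) =
      (2 * p.eval (Fintype.card (ι k)) + 3) * q.eval (p.eval (Fintype.card (ι k))) := by
    simp
  refine ⟨C', ?_, h2.mono ?_, h3⟩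
  · rw [h1, h5]; nlinarith
  · rw [h4, h5]
    calc (2 * m + 2) * q.eval m + q.eval m = (2 * m + 3) * q.eval m := by ring
      _ ≤ _ := Nat.mul_le_mul (by omega) hle

/-! ### The odd-max-bit function by its top bit -/

theorem omb_cases {n : ℕ} (w : Fin n → Bool) :
    ((∀ i, w i = false) ∧ omb w = false) ∨
      ∃ i, w i = true ∧ (∀ i', w i' = true → i' ≤ i) ∧ omb w = decide (((i : ℕ) + 1) % 2 = 1) := by
  rcases (Finset.univ.filter (fun i => w i = true)).eq_empty_or_nonempty with h | h
  · left
    refine ⟨fun i => ?_, by simp [omb, h]⟩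
    have := Finset.filter_eq_empty_iff.1 h (Finset.mem_univ i)
    simpa using this
  · right
    obtain ⟨i, hi, hsup⟩ := Finset.exists_mem_eq_sup _ h (fun i : Fin n => (i : ℕ) + 1)
    refine ⟨i, (Finset.mem_filter.1 hi).2, fun i' hi' => ?_, by rw [omb, hsup]⟩
    have : (i' : ℕ) + 1 ≤ i + 1 := by
      rw [← hsup]
      exact Finset.le_sup (f := fun i : Fin n => (i : ℕ) + 1) (by simpa using hi')
    rw [Fin.le_def]; omega

/-! ### The min-plus polynomial threshold function -/

/-- The form `(i + 1) (1 - xᵢ - yᵢ)`. -/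
def pairForm {n : ℕ} (i : Fin n) : LinForm (Fin n ⊕ Fin n) where
  coeff s := if s = Sum.inl i ∨ s = Sum.inr i then -((i : ℤ) + 1) else 0
  const := (i : ℤ) + 1

theorem pairForm_eval {n : ℕ} (i : Fin n) (z : Fin n ⊕ Fin n → Bool) :
    (pairForm i).eval z = ((i : ℤ) + 1) *
      (1 - (if z (Sum.inl i) then 1 else 0) - (if z (Sum.inr i) then 1 else 0)) := by
  simp only [LinForm.eval, pairForm, Fintype.sum_sum_type, Sum.inl.injEq, Sum.inr.injEq,
    reduceCtorEq, or_false, false_or, ite_mul, zero_mul, Finset.sum_ite_eq', Finset.mem_univ, if_true]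
  ring

theorem pairForm_eval_of_and {n : ℕ} {i : Fin n} {z : Fin n ⊕ Fin n → Bool}
    (h : (z (Sum.inl i) && z (Sum.inr i)) = true) : (pairForm i).eval z = -((i : ℤ) + 1) := by
  rw [Bool.and_eq_true] at h
  rw [pairForm_eval, h.1, h.2]; simp

theorem pairForm_eval_nonneg {n : ℕ} {i : Fin n} {z : Fin n ⊕ Fin n → Bool}
    (h : (z (Sum.inl i) && z (Sum.inr i)) = false) : 0 ≤ (pairForm i).eval z := by
  rw [pairForm_eval]
  have hi : (0 : ℤ) ≤ (i : ℤ) + 1 := by positivity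
  refine mul_nonneg hi ?_
  cases h1 : z (Sum.inl i) <;> cases h2 : z (Sum.inr i) <;> simp_all

theorem pairForm_weightLE {n : ℕ} (i : Fin n) : (pairForm i).WeightLE (n + 1) := by
  have hi := i.2
  have h : |(i : ℤ) + 1| ≤ ((n + 1 : ℕ) : ℤ) := by
    rw [abs_of_nonneg (by positivity)]; omega
  refine ⟨fun s => ?_, h⟩
  simp only [pairForm]
  split_ifs
  · rwa [abs_neg]
  · rw [abs_zero]; positivity

theorem hasMpPTF_ombAnd2 (n : ℕ) : HasMpPTF (ombAnd2 n) (n + 1) (n + 1) := by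
  -- Even 1-based indices go right, odd ones left. The constant form `-1` beats the left side when
  -- no conjunction holds, and only ties with index 1, where `≤` still gives 1.
  let R : Fin (n / 2 + 1) → LinForm (Fin n ⊕ Fin n) := fun b =>
    if h : (b : ℕ) = 0 then ⟨fun _ => 0, -1⟩ else pairForm ⟨2 * b - 1, by omega⟩
  let L : Fin ((n + 1) / 2) → LinForm (Fin n ⊕ Fin n) := fun a => pairForm ⟨2 * a, by omega⟩
  refine ⟨(n + 1) / 2, n / 2 + 1, L, R, by omega, fun a => pairForm_weightLE _, fun b => ?_,
    fun z => ?_⟩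
  · simp only [R]
    split_ifs
    · refine ⟨fun i => by simp; positivity, ?_⟩
      rw [abs_neg, abs_one]; push_cast; omega
    · exact pairForm_weightLE _
  set w : Fin n → Bool := fun i => z (Sum.inl i) && z (Sum.inr i) with hw
  have hval1 : ∀ i, w i = true → (pairForm i).eval z = -((i : ℤ) + 1) :=
    fun i hi => pairForm_eval_of_and hi
  have hval0 : ∀ i, w i = false → 0 ≤ (pairForm i).eval z := fun i hi => pairForm_eval_nonneg hi
  have hR0 : ∀ b : Fin (n / 2 + 1), (b : ℕ) = 0 → (R b).eval z = -1 := by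
    intro b hb
    have e : R b = ⟨fun _ => 0, -1⟩ := dif_pos hb
    rw [e]; simp [LinForm.eval]
  have hlt : ∀ b, (∀ a, (R b).eval z < (L a).eval z) →
      ¬ Finset.univ.inf (fun i => ((L i).eval z : WithTop ℤ)) ≤
          Finset.univ.inf (fun j => ((R j).eval z : WithTop ℤ)) := by
    intro b hb
    rw [not_le]
    refine lt_of_le_of_lt (Finset.inf_le (Finset.mem_univ b)) ?_
    rw [Finset.lt_inf_iff (WithTop.coe_lt_top _)]
    intro a _
    exact_mod_cast hb a
  change omb w = true ↔ _
  rcases omb_cases w with ⟨h0, homb⟩ | ⟨i, hi, hmax, homb⟩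
  · rw [homb]
    simp only [Bool.false_eq_true, false_iff]
    refine hlt ⟨0, by omega⟩ fun a => ?_
    rw [hR0 _ rfl]
    have := hval0 ⟨2 * a, by omega⟩ (h0 _)
    simp only [L]; omega
  · have hge : ∀ i' : Fin n, -((i : ℤ) + 1) ≤ (pairForm i').eval z ∧
        (i' ≠ i → -((i : ℤ) + 1) < (pairForm i').eval z) := by
      intro i'
      cases h : w i'
      · have := hval0 i' h
        exact ⟨by omega, fun _ => by omega⟩
      · rw [hval1 i' h]
        have h1 := Fin.le_def.1 (hmax i' h)
        refine ⟨by omega, fun hne => ?_⟩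
        have : (i' : ℕ) ≠ i := fun e => hne (Fin.ext e)
        omega
    rw [homb, decide_eq_true_iff]
    constructor
    · intro hodd
      refine Finset.le_inf fun b _ => ?_
      refine (Finset.inf_le (Finset.mem_univ (⟨(i : ℕ) / 2, by omega⟩ : Fin ((n + 1) / 2)))).trans ?_
      have e : L ⟨(i : ℕ) / 2, by omega⟩ = pairForm i := by
        simp only [L]; congr 1; ext; simp only; omega
      rw [e, hval1 i hi]
      norm_cast
      by_cases hb : (b : ℕ) = 0
      · rw [hR0 b hb]; omega
      · simp only [R, hb, dif_neg, not_false_eq_true]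
        have := (hge ⟨2 * b - 1, by omega⟩).1
        omega
    · intro hle
      by_contra hodd
      refine hlt ⟨((i : ℕ) + 1) / 2, by omega⟩ (fun a => ?_) hle
      have e : R ⟨((i : ℕ) + 1) / 2, by omega⟩ = pairForm i := by
        have : ((i : ℕ) + 1) / 2 ≠ 0 := by omega
        simp only [R, this, dif_neg, not_false_eq_true]; congr 1; ext; simp only; omega
      rw [e, hval1 i hi]
      refine (hge _).2 fun h => ?_
      have := congrArg Fin.val h
      simp only at this
      omega

/-! ### Hamming nearest neighbor representations from anchors of different parities -/

/-- The value `±1` of a bit as an integer. -/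
def intSign (b : Bool) : ℤ := if b then -1 else 1

/-- The distance of the Boolean vector `x` to the anchor `a`, up to a term that does not depend
on `a`. -/
def score {κ : Type} [Fintype κ] (a x : κ → Bool) : ℤ := ∑ c, if a c then intSign (x c) else 0

theorem sqDist_toReal {κ : Type} [Fintype κ] (x a : κ → Bool) :
    sqDist (toReal x) (toReal a) = ∑ c, toReal x c + score a x := by
  rw [score, Int.cast_sum, sqDist, ← Finset.sum_add_distrib]
  refine Finset.sum_congr rfl fun c _ => ?_
  cases h : x c <;> cases h' : a c <;> simp [toReal, intSign, h, h']

theorem sqDist_toReal_lt_iff {κ : Type} [Fintype κ] (x a a' : κ → Bool) :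
    sqDist (toReal x) (toReal a) < sqDist (toReal x) (toReal a') ↔ score a x < score a' x := by
  rw [sqDist_toReal, sqDist_toReal, add_lt_add_iff_left, Int.cast_lt]

theorem toReal_injective {κ : Type} : Function.Injective (toReal : (κ → Bool) → κ → ℝ) := by
  intro a a' h
  funext c
  have := congrFun h c
  cases h1 : a c <;> cases h2 : a' c <;> simp_all [toReal]

/-- Each summand is `±1` on the support of `a`, so the parity of the score is that of the anchor's
weight, whatever `x` is. -/
theorem score_emod_two {κ : Type} [Fintype κ] (a x : κ → Bool) :
    score a x % 2 = score a (fun _ => false) % 2 := by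
  refine Int.ModEq.eq ?_
  rw [Int.modEq_iff_dvd, score, score, ← Finset.sum_sub_distrib]
  refine Finset.dvd_sum fun c _ => ?_
  cases h : a c <;> cases h' : x c <;> simp [intSign]

/-- If the positive anchors have even weight and the negative ones odd weight, there are no ties. -/
theorem hasHNNRep_of_parity {κ J : Type} [Fintype κ] [Fintype J] [DecidableEq J]
    (A : J → κ → Bool) (hA : Function.Injective A) (pos : J → Prop) [DecidablePred pos]
    (hpar : ∀ j, pos j ↔ score (A j) (fun _ => false) % 2 = 0) (hneg : ∃ j, ¬ pos j) :
    HasHNNRep (fun x => decide (∃ j, pos j ∧ ∀ j', ¬ pos j' → score (A j) x < score (A j') x))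
      (Fintype.card J) := by
  classical
  have hinj : Function.Injective fun j => toReal (A j) := toReal_injective.comp hA
  refine ⟨(Finset.univ.filter pos).image fun j => toReal (A j),
    (Finset.univ.filter fun j => ¬ pos j).image fun j => toReal (A j), ⟨?_, fun x => ⟨?_, ?_⟩⟩,
    ?_, ?_, ?_⟩
  · rw [Finset.disjoint_image hinj]
    exact Finset.disjoint_filter_filter_not _ _ _
  · simp [sqDist_toReal_lt_iff]
  · simp only [decide_eq_false_iff_not, Finset.mem_image, Finset.mem_filter, Finset.mem_univ,
      true_and, forall_exists_index, and_imp, forall_apply_eq_imp_iff₂, exists_exists_and_eq_and,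
      sqDist_toReal_lt_iff]
    constructor
    · intro h
      -- A negative anchor of least score is no farther than any positive one, and parity makes the
      -- inequality strict.
      obtain ⟨j₀, h₀⟩ := hneg
      obtain ⟨j, hj, hmin⟩ := Finset.exists_min_image (Finset.univ.filter fun j => ¬ pos j)
        (fun j => score (A j) x) ⟨j₀, by simpa using h₀⟩
      have hj' : ¬ pos j := by simpa using hj
      refine ⟨j, hj', fun i hi => ?_⟩
      push Not at h
      obtain ⟨j', hj1, hj2⟩ := h i hi
      have h1 := hmin j' (by simpa using hj1)
      have h2 : score (A j) x ≠ score (A i) x := by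
        intro e
        have h3 := (hpar i).1 hi
        have h4 := mt (hpar j).2 hj'
        rw [← score_emod_two _ x] at h3 h4
        rw [e] at h4
        exact h4 h3
      omega
    · rintro ⟨j, hj, h⟩ ⟨i, hi, h'⟩
      exact lt_asymm (h i hi) (h' j hj)
  · intro a ha i
    obtain ⟨j, -, rfl⟩ := Finset.mem_image.1 ha
    cases h : A j i <;> simp [toReal, h]
  · intro a ha i
    obtain ⟨j, -, rfl⟩ := Finset.mem_image.1 ha
    cases h : A j i <;> simp [toReal, h]
  · rw [Finset.card_image_of_injective _ hinj, Finset.card_image_of_injective _ hinj,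
      Finset.card_filter_add_card_filter_not, Finset.card_univ]

theorem HasHNNRep.congr {κ κ' : Type} [Fintype κ] [Fintype κ'] (e : κ ≃ κ') {f : BoolFn κ} {m : ℕ}
    (h : HasHNNRep f m) : HasHNNRep (fun x : κ' → Bool => f (x ∘ e)) m := by
  classical
  obtain ⟨P, N, ⟨hd, hrep⟩, hP, hN, hm⟩ := h
  have hinj : Function.Injective fun a : κ → ℝ => a ∘ e.symm := e.symm.surjective.injective_comp_right
  have hdist : ∀ (x : κ' → Bool) (a : κ → ℝ),
      sqDist (toReal x) (a ∘ e.symm) = sqDist (toReal (x ∘ e)) a := by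
    intro x a
    rw [sqDist, sqDist, ← Equiv.sum_comp e]
    simp [toReal]
  refine ⟨P.image fun a => a ∘ e.symm, N.image fun a => a ∘ e.symm, ⟨?_, fun x => ?_⟩, ?_, ?_, ?_⟩
  · rwa [Finset.disjoint_image hinj]
  · simpa [hdist] using hrep (x ∘ e)
  · intro a ha i
    obtain ⟨a', h', rfl⟩ := Finset.mem_image.1 ha
    exact hP a' h' _
  · intro a ha i
    obtain ⟨a', h', rfl⟩ := Finset.mem_image.1 ha
    exact hN a' h' _
  · rw [Finset.card_image_of_injective _ hinj, Finset.card_image_of_injective _ hinj, hm]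

/-- Without negative anchors any nonempty set of positive ones works, and `n + 1 ≤ 2 ^ n`. -/
theorem hasHNNRep_const_true (n : ℕ) : HasHNNRep (fun _ : Fin n → Bool => true) (n + 1) := by
  classical
  obtain ⟨T, -, hT⟩ := Finset.exists_subset_card_eq (s := (Finset.univ : Finset (Fin n → Bool)))
    (n := n + 1) (by simpa using Nat.lt_two_pow_self)
  have hne : T.Nonempty := Finset.card_pos.1 (by omega)
  refine ⟨T.image toReal, ∅, ⟨by simp, fun x => ⟨?_, by simp⟩⟩, ?_, by simp, ?_⟩
  · obtain ⟨a, ha⟩ := hne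
    simp only [true_iff]
    exact ⟨toReal a, Finset.mem_image_of_mem _ ha, by simp⟩
  · intro a ha i
    obtain ⟨a', -, rfl⟩ := Finset.mem_image.1 ha
    cases h : a' i <;> simp [toReal, h]
  · rw [Finset.card_image_of_injective _ toReal_injective, hT, Finset.card_empty]

/-! ### Anchors for `OMB ∘ AND₂` -/

/-- The coordinates: `k` copies of each of the `2k` variables, and two constants. -/
abbrev Coord (k : ℕ) : Type := ((Fin k ⊕ Fin k) × Fin k) ⊕ Bool

/-- The anchors: `none` for the default value 0, `some i` for the `i`-th conjunction, and `inr c`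
for an anchor that is never nearest to a substituted input. -/
def anchor {k : ℕ} {T : Finset (Coord k)} : Option (Fin k) ⊕ T → Coord k → Bool
  | .inl none, c => decide (c = Sum.inr true)
  | .inl (some i), c => Sum.elim (fun s => decide ((s.1 = Sum.inl i ∨ s.1 = Sum.inr i) ∧ s.2 ≤ i))
      (fun b => b && decide (((i : ℕ) + 1) % 2 = 0)) c
  | .inr c', c => decide ((c' : Coord k) ≠ Sum.inr false ∧ (c = c' ∨ c = Sum.inr false))

/-- The positive anchors. -/
def PosAnchor {k : ℕ} {T : Finset (Coord k)} : Option (Fin k) ⊕ T → Prop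
  | .inl none => False
  | .inl (some i) => ((i : ℕ) + 1) % 2 = 1
  | .inr _ => True

theorem score_anchor_none {k : ℕ} {T : Finset (Coord k)} (x : Coord k → Bool) :
    score (anchor (T := T) (.inl none)) x = intSign (x (Sum.inr true)) := by
  simp [score, anchor]

theorem score_anchor_some {k : ℕ} {T : Finset (Coord k)} (i : Fin k) (x : Coord k → Bool)
    (u : Fin k ⊕ Fin k → Bool) (hx : ∀ s t, x (Sum.inl (s, t)) = u s) :
    score (anchor (T := T) (.inl (some i))) x =
      ((i : ℤ) + 1) * (intSign (u (Sum.inl i)) + intSign (u (Sum.inr i))) +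
        if ((i : ℕ) + 1) % 2 = 0 then intSign (x (Sum.inr true)) else 0 := by
  have h1 : ∀ a : ℤ, ∑ t : Fin k, (if t ≤ i then a else 0) = ((i : ℤ) + 1) * a := by
    intro a
    rw [← Finset.sum_filter, Finset.sum_const, nsmul_eq_mul]
    have : Finset.univ.filter (fun t => t ≤ i) = Finset.Iic i := by ext; simp
    rw [this, Fin.card_Iic]
    push_cast; ring
  have h2 : ∀ (s s' : Fin k) (P : Prop) [Decidable P] (a : ℤ),
      (if s = s' ∧ P then a else 0) = if s = s' then (if P then a else 0) else 0 := by
    intro s s' P _ a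
    split_ifs <;> simp_all
  simp only [score, anchor, Fintype.sum_sum_type, Fintype.sum_prod_type, Sum.elim_inl,
    Sum.elim_inr, hx, decide_eq_true_eq, Sum.inl.injEq, Sum.inr.injEq, reduceCtorEq, or_false,
    false_or, Fintype.sum_bool, Bool.true_and, Bool.false_and, h2]
  have h3 : ∀ g : Fin k → Bool, ∑ s : Fin k, ∑ t : Fin k,
      (if s = i then (if t ≤ i then intSign (g s) else 0) else 0) =
        ((i : ℤ) + 1) * intSign (g i) := by
    intro g
    rw [Finset.sum_eq_single i]
    · simp only [if_true]; exact h1 _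
    · intro s _ hs; simp [hs]
    · simp
  rw [h3 (fun s => u (Sum.inl s)), h3 (fun s => u (Sum.inr s))]
  simp
  ring

theorem score_anchor_inr {k : ℕ} {T : Finset (Coord k)} (c : T) (x : Coord k → Bool)
    (hx : x (Sum.inr false) = false) :
    score (anchor (.inr c)) x =
      if (c : Coord k) = Sum.inr false then 0 else intSign (x c) + 1 := by
  simp only [score, anchor, decide_eq_true_eq]
  split_ifs with h
  · simp [h]
  · simp only [ne_eq, h, not_false_eq_true, true_and]
    have h1 : ∀ c' : Coord k, (if c' = c ∨ c' = Sum.inr false then intSign (x c') else 0) =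
        (if c' = c then intSign (x c') else 0) +
          (if c' = Sum.inr false then intSign (x c') else 0) := by
      intro c'
      by_cases h1 : c' = c
      · subst h1; simp [h]
      · simp [h1]
    rw [Finset.sum_congr rfl fun c' _ => h1 c', Finset.sum_add_distrib, Finset.sum_ite_eq',
      Finset.sum_ite_eq']
    simp [hx, intSign]

/-- The `2(i + 1)` copies have even weight; the constant coordinate `inr true` makes exactly the
negative anchors odd. Padding anchors have weight 0 or 2. -/
theorem posAnchor_iff {k : ℕ} {T : Finset (Coord k)} (j : Option (Fin k) ⊕ T) :
    PosAnchor j ↔ score (anchor j) (fun _ => false) % 2 = 0 := by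
  rcases j with (_ | i) | c
  · simp [score_anchor_none, PosAnchor, intSign]
  · rw [score_anchor_some i _ (fun _ => false) (fun _ _ => rfl)]
    simp only [PosAnchor, intSign, Bool.false_eq_true, if_false]
    split_ifs <;> omega
  · rw [score_anchor_inr c _ rfl]
    simp only [PosAnchor, intSign, Bool.false_eq_true, if_false, true_iff]
    split_ifs <;> rfl

theorem anchor_injective {k : ℕ} {T : Finset (Coord k)} :
    Function.Injective (anchor : Option (Fin k) ⊕ T → Coord k → Bool) := by
  have hself : ∀ i : Fin k, anchor (T := T) (.inl (some i)) (Sum.inl (Sum.inl i, i)) = true := by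
    intro i; simp [anchor]
  have hsome : ∀ i i' : Fin k,
      anchor (T := T) (.inl (some i)) (Sum.inl (Sum.inl i', i')) = true → i' = i := by
    intro i i' h
    simp only [anchor, Sum.elim_inl, decide_eq_true_eq, Sum.inl.injEq, reduceCtorEq, or_false] at h
    exact h.1
  have hzero : ∀ j, anchor (T := T) (.inl j) (Sum.inr false) = false := by
    rintro (_ | i) <;> simp [anchor]
  have hinr : ∀ (o : Option (Fin k)) (c : T), anchor (T := T) (.inl o) ≠ anchor (.inr c) := by
    intro o c h
    by_cases hc : (c : Coord k) = Sum.inr false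
    · have h1 : ∀ c', anchor (T := T) (.inl o) c' = false := by
        intro c'; rw [h]; simp [anchor, hc]
      rcases o with _ | i
      · have := h1 (Sum.inr true); simp [anchor] at this
      · have := h1 (Sum.inl (Sum.inl i, i)); rw [hself] at this; simp at this
    · have h1 := congrFun h (Sum.inr false)
      rw [hzero] at h1
      simp [anchor, hc] at h1
  rintro ((_ | i) | c) ((_ | i') | c') h
  · rfl
  · have := congrFun h (Sum.inl (Sum.inl i', i'))
    rw [hself] at this; simp [anchor] at this
  · exact absurd h (hinr _ _)
  · have := congrFun h (Sum.inl (Sum.inl i, i))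
    rw [hself] at this; simp [anchor] at this
  · have := congrFun h (Sum.inl (Sum.inl i, i))
    rw [hself] at this
    rw [hsome i' i this.symm]
  · exact absurd h (hinr _ _)
  · exact absurd h.symm (hinr _ _)
  · exact absurd h.symm (hinr _ _)
  · congr 1
    ext1
    by_contra hne
    have h1 := congrFun h c
    have h2 := congrFun h c'
    by_cases hc : (c : Coord k) = Sum.inr false
    · have hc' : (c' : Coord k) ≠ Sum.inr false := fun e => hne (hc.trans e.symm)
      simp [anchor, hc, hc'] at h2
    · simp [anchor, hc, hne] at h1

/-- The substitution of variables and constants for the coordinates. -/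
def coordSubst {k : ℕ} : Coord k → (Fin k ⊕ Fin k) ⊕ Bool := Sum.map Prod.fst id

/-- A satisfied conjunction scores `-2(i + 1)`, lowered by 1 for negative anchors; the gaps of 2
dominate this correction, so the largest index wins. Unsatisfied positive anchors and padding score
at least 0, above the default's `-1`. -/
theorem ombAnd2_eq_anchor {k : ℕ} (T : Finset (Coord k)) (z : Fin k ⊕ Fin k → Bool) :
    ombAnd2 k z = true ↔ ∃ j : Option (Fin k) ⊕ T, PosAnchor j ∧
      ∀ j' : Option (Fin k) ⊕ T, ¬ PosAnchor j' → score (anchor j) (fun c => Sum.elim z id (coordSubst c)) <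
        score (anchor j') (fun c => Sum.elim z id (coordSubst c)) := by
  set x : Coord k → Bool := fun c => Sum.elim z id (coordSubst c) with hx
  set w : Fin k → Bool := fun i => z (Sum.inl i) && z (Sum.inr i) with hw
  have hnone : score (anchor (T := T) (.inl none)) x = -1 := by
    rw [score_anchor_none]; simp [hx, coordSubst, intSign]
  have hextra : ∀ c : T, 0 ≤ score (anchor (.inr c)) x := by
    intro c
    rw [score_anchor_inr c x (by simp [hx, coordSubst])]
    split_ifs
    · rfl
    · cases x c <;> simp [intSign]
  have hsome : ∀ i : Fin k, score (anchor (T := T) (.inl (some i))) x =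
      ((i : ℤ) + 1) * (intSign (z (Sum.inl i)) + intSign (z (Sum.inr i))) +
        if ((i : ℕ) + 1) % 2 = 0 then -1 else 0 := by
    intro i
    rw [score_anchor_some i x z (fun s t => by simp [hx, coordSubst])]
    simp [hx, coordSubst, intSign]
  have hsome1 : ∀ i : Fin k, w i = true → score (anchor (T := T) (.inl (some i))) x =
      -2 * ((i : ℤ) + 1) + if ((i : ℕ) + 1) % 2 = 0 then -1 else 0 := by
    intro i hi
    rw [hw, Bool.and_eq_true] at hi
    rw [hsome, hi.1, hi.2]
    simp [intSign]; ring
  have hsome0 : ∀ i : Fin k, w i = false →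
      (if ((i : ℕ) + 1) % 2 = 0 then -1 else 0) ≤ score (anchor (T := T) (.inl (some i))) x := by
    intro i hi
    rw [hsome]
    refine le_add_of_nonneg_left (mul_nonneg (by positivity) ?_)
    cases h1 : z (Sum.inl i) <;> cases h2 : z (Sum.inr i) <;> simp_all [intSign]
  change omb w = true ↔ _
  rcases omb_cases w with ⟨h0, homb⟩ | ⟨i, hi, hmax, homb⟩
  · rw [homb]
    simp only [Bool.false_eq_true, false_iff]
    rintro ⟨j, hj, h⟩
    have h1 := h (.inl none) (by simp [PosAnchor])
    rw [hnone] at h1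
    rcases j with (_ | i) | c
    · exact hj
    · have h2 := hsome0 i (h0 i)
      have h3 : ((i : ℕ) + 1) % 2 = 1 := hj
      rw [if_neg (by omega)] at h2
      omega
    · have := hextra c; omega
  · rw [homb, decide_eq_true_iff]
    have hi1 := hsome1 i hi
    constructor
    · intro hodd
      rw [if_neg (by omega)] at hi1
      refine ⟨.inl (some i), hodd, ?_⟩
      rintro ((_ | i') | c) hj
      · rw [hi1, hnone]; omega
      · have h3 : ¬ ((i' : ℕ) + 1) % 2 = 1 := hj
        rw [hi1]
        cases h : w i'
        · have h2 := hsome0 i' h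
          rw [if_pos (by omega)] at h2
          omega
        · have h2 := Fin.le_def.1 (hmax i' h)
          have h4 := hsome1 i' h
          rw [if_pos (by omega)] at h4
          omega
      · exact absurd trivial hj
    · rintro ⟨j, hj, h⟩
      by_contra hodd
      rw [if_pos (by omega)] at hi1
      have h1 := h (.inl (some i)) hodd
      rw [hi1] at h1
      rcases j with (_ | i') | c
      · exact hj
      · have h3 : ((i' : ℕ) + 1) % 2 = 1 := hj
        cases h' : w i'
        · have h2 := hsome0 i' h'
          rw [if_neg (by omega)] at h2
          omega
        · have h2 := Fin.le_def.1 (hmax i' h')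
          have h4 := hsome1 i' h'
          rw [if_neg (by omega)] at h4
          omega
      · have := hextra c; omega

/-- The `t` padding anchors adjust the anchor count: `t = 0` gives `k + 1` anchors, and larger `t`
serves to match the number of variables. -/
theorem exists_hasHNNRep_isSubfunction (k t : ℕ) (ht : t ≤ 2 * k ^ 2 + 2) :
    ∃ g : BoolFn (Fin (2 * k ^ 2 + 2)),
      HasHNNRep g (k + 1 + t) ∧ IsSubfunction (ombAnd2 k) g := by
  classical
  have hcard : Fintype.card (Coord k) = 2 * k ^ 2 + 2 := by
    simp only [Fintype.card_sum, Fintype.card_prod, Fintype.card_fin, Fintype.card_bool]; ring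
  obtain ⟨T, -, hT⟩ := Finset.exists_subset_card_eq (s := (Finset.univ : Finset (Coord k)))
    (n := t) (by rwa [Finset.card_univ, hcard])
  let e : Coord k ≃ Fin (2 * k ^ 2 + 2) := Fintype.equivFinOfCardEq hcard
  have h := (hasHNNRep_of_parity (anchor (T := T)) anchor_injective PosAnchor posAnchor_iff
    ⟨.inl none, by simp [PosAnchor]⟩).congr e
  have hJ : Fintype.card (Option (Fin k) ⊕ T) = k + 1 + t := by
    simp [hT]
  rw [hJ] at h
  refine ⟨_, h, fun c => coordSubst (e.symm c), fun z => ?_⟩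
  rw [Bool.eq_iff_iff, ombAnd2_eq_anchor T z, decide_eq_true_iff]
  simp [Function.comp_def]

/-! ### The separation -/

theorem exists_family :
    ∃ f : BoolFamily Fin, (∀ n, HasHNNRep (f n) (n + 1)) ∧
      ∀ k, IsSubfunction (ombAnd2 k) (f (2 * k ^ 2 + 2)) := by
  have h : ∀ n, ∃ g : BoolFn (Fin n), HasHNNRep g (n + 1) ∧
      ∀ k, n = 2 * k ^ 2 + 2 → IsSubfunction (ombAnd2 k) g := by
    intro n
    by_cases hn : ∃ k, n = 2 * k ^ 2 + 2
    · obtain ⟨k, rfl⟩ := hn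
      -- With `n = 2 * k ^ 2 + 2`, padding by `n - k` anchors brings `k + 1` up to `n + 1`.
      obtain ⟨g, hg, hsub⟩ := exists_hasHNNRep_isSubfunction k (2 * k ^ 2 + 2 - k) (by omega)
      have hk : k ≤ 2 * k ^ 2 + 2 := by nlinarith
      refine ⟨g, ?_, fun k' hk' => ?_⟩
      · convert hg using 1; omega
      · have : k ^ 2 = k' ^ 2 := by omega
        obtain rfl : k = k' := Nat.pow_left_injective two_ne_zero this
        exact hsub
    · exact ⟨_, hasHNNRep_const_true n, fun k hk => absurd ⟨k, hk⟩ hn⟩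
  choose f hf hf' using h
  exact ⟨f, hf, fun k => hf' _ k rfl⟩

end NearestNeighbor

theorem mainTheorem8 :
    ¬ (HNN Fin ⊆ MAJMAJ Fin) ∧
    (∃ f : BoolFamily Fin, (∀ n : ℕ, HasHNNRep (f n) (n + 1)) ∧ f ∉ MAJMAJ Fin) ∧
    (∀ n : ℕ, HasMpPTF (ombAnd2 n) (n + 1) (n + 1)) ∧
    ombAnd2 ∈ subClosure (HNN Fin) (fun n => Fin n ⊕ Fin n) ∧
    (∃ p : Polynomial ℕ, ∀ n : ℕ, ∃ (m : ℕ) (g : BoolFn (Fin m)),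
      m ≤ p.eval n ∧ HasHNNRep g (n + 1) ∧ IsSubfunction (ombAnd2 n) g) ∧
    ombAnd2 ∉ MAJMAJ (fun n => Fin n ⊕ Fin n) := by
  obtain ⟨f, hf, hsub⟩ := exists_family
  have hfHNN : f ∈ HNN Fin := ⟨Polynomial.X + 1, fun n => ⟨n + 1, by simp, hf n⟩⟩
  have hpoly : ∀ k : ℕ, (2 * Polynomial.X ^ 2 + 2 : Polynomial ℕ).eval k = 2 * k ^ 2 + 2 := by
    intro k; simp
  have hvars : ∀ k, ∃ m ≤ (2 * Polynomial.X ^ 2 + 2 : Polynomial ℕ).eval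
      (Fintype.card (Fin k ⊕ Fin k)), IsSubfunction (ombAnd2 k) (f m) := by
    intro k
    refine ⟨_, ?_, hsub k⟩
    rw [hpoly, Fintype.card_sum, Fintype.card_fin]
    have : k ≤ k + k := by omega
    gcongr
  have hfMAJ : f ∉ MAJMAJ Fin := fun h =>
    ombAnd2_notMem_MAJMAJ (mem_MAJMAJ_of_isSubfunction h _ hvars)
  refine ⟨fun h => hfMAJ (h hfHNN), ⟨f, hf, hfMAJ⟩, hasMpPTF_ombAnd2, ⟨f, hfHNN, _, hvars⟩,
    ⟨2 * Polynomial.X ^ 2 + 2, fun n => ?_⟩, ombAnd2_notMem_MAJMAJ⟩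
  obtain ⟨g, hg, hg'⟩ := exists_hasHNNRep_isSubfunction n 0 (by omega)
  exact ⟨_, g, (hpoly n).ge, hg, hg'⟩
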